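/- Let $\ell\ge 1$ and let $a_1,\dots,a_\ell\ge 1$ be integers, with indices read modulo $\ell$, and let $\alpha=[0;\overline{a_1,\dots,a_\ell}]$. Define $p_0=1$, $p_1=0$, $q_0=0$, $q_1=1$ and, for $n\ge 1$, $p_{n+1}=a_np_n+p_{n-1}$, $q_{n+1}=a_nq_n+q_{n-1}$. Put $$c=q_{\ell+1}+p_\ell,\qquad a=\frac{c+\sqrt{c^2+4(-1)^{\ell-1}}}{2},\qquad b=\frac{c-\sqrt{c^2+4(-1)^{\ell-1}}}{2},$$ and, for $0\le k\le \ell-1$, $$c_k=\frac{q_{\ell+k}-bq_k}{a-b},\qquad e_k=(-1)^{k-1}\frac{|aq_k-q_{\ell+k}|}{q_\ell},$$ extended to all $k\ge 0$ periodically modulo $\ell$. For $1\le k\le \ell$ let $\alpha_{\sigma_k}=[0;\overline{a_{k-1},\dots,a_1,a_\ell,\dots,a_k}]$ (so that $\alpha_{\sigma_1}=[0;\overline{a_\ell,\dots,a_1}]$) and, for $t\ge 1$, $$u_k(t)=2\Big(\frac{t}{|e_kc_k|}-\{t\alpha_{\sigma_k}\}+\frac12\Big),$$ where $\{\cdot\}$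 is the fractional part. For $\varepsilon\in\mathbb R$ and $n\ge1$ let $$P_{q_n}(\alpha,\varepsilon)=\prod_{r=1}^{q_n}2\Big|\sin\pi\Big(r\alpha+(-1)^{n+1}\frac{\varepsilon}{q_n}\Big)\Big|.$$ Then for each $k=1,\dots,\ell$ the functions $\varepsilon\mapsto P_{q_{m\ell+k}}(\alpha,\varepsilon)$ converge, as $m\to\infty$, locally uniformly on $\mathbb R$ to a function $G_k(\alpha,\cdot)$, which is given for all $\varepsilon\in\mathbb R$ by the following formulas, in which the infinite products converge (unconditionally). If $\ell$ is even, $$G_k(\alpha,\varepsilon)=\Big|1+\frac{\varepsilon}{|e_kc_k|}\Big|\Big(1+\frac1{|b|^2}\Big)^{\frac1{c-2}}\frac1{(c!)^{1/(c-2)}}\prod_{t=1}^\infty\left(\left|1-\frac{\big(1+\frac{2\varepsilon}{|e_kc_k|}\big)^2}{u_k(t)^2}\right|\,\left|1-\frac{\big(1+\frac2{|b|^2}\big)^2}{u_k(t)^2}\right|^{\frac1{c-2}}\prod_{s=1}^{c-1}\left|1-\frac{(1+2s)^2}{u_k(t)^2}\right|^{-\frac1{c-2}}\right);$$ if $\ell$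 is odd, $$G_k(\alpha,\varepsilon)=\frac{\big|1+\frac{\varepsilon}{|e_kc_k|}\big|}{\prod_{s=1}^{c}|s-a|^{1/c}}\prod_{t=1}^\infty\left(\left|1-\frac{\big(1+\frac{2\varepsilon}{|e_kc_k|}\big)^2}{u_k(t)^2}\right|\prod_{s=0}^{c-1}\left|1-\frac{\big(1+2(s-\frac1{|b|})\big)^2}{u_k(t)^2}\right|^{-\frac1c}\right).$$ In both cases $G_k(\alpha,\cdot)$ is continuous on $\mathbb R$, and it is $C^\infty$ on the (open) set where it is non-zero. -/

import Mathlib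

open Filter Topology
open scoped ContDiff

noncomputable section

namespace Sudler

/-! ### Continued fractions `[0; d 1, d 2, d 3, …]` (the value `d 0` is never used) -/

/-- Numerators: `p 0 = 1`, `p 1 = 0`, `p (n + 1) = d n * p n + p (n - 1)`. -/
def cfNum (d : ℕ → ℕ) : ℕ → ℕ
  | 0 => 1
  | 1 => 0
  | n + 2 => d (n + 1) * cfNum d (n + 1) + cfNum d n

/-- Denominators: `q 0 = 0`, `q 1 = 1`, `q (n + 1) = d n * q n + q (n - 1)`. -/
def cfDen (d : ℕ → ℕ) : ℕ → ℕ
  | 0 => 0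
  | 1 => 1
  | n + 2 => d (n + 1) * cfDen d (n + 1) + cfDen d n

/-- The value of `[0; d 1, d 2, …]`: the limit of the convergents `p n / q n`. -/
def cfValue (d : ℕ → ℕ) : ℝ :=
  limUnder atTop (fun n : ℕ => (cfNum d n : ℝ) / (cfDen d n : ℝ))

theorem cfDen_pos (d : ℕ → ℕ) (hd : ∀ n, 1 ≤ d n) (n : ℕ) :
    1 ≤ cfDen d (n + 1) := by
  induction n with
  | zero => simp [cfDen]
  | succ n ih =>
    rw [cfDen]
    have := Nat.mul_le_mul (hd (n + 1)) ih
    omega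

theorem cf_det (d : ℕ → ℕ) (n : ℕ) :
    (cfNum d n : ℝ) * cfDen d (n + 1) - cfNum d (n + 1) * cfDen d n = (-1) ^ n := by
  induction n with
  | zero => simp [cfNum, cfDen]
  | succ n ih =>
    rw [cfNum, cfDen, pow_succ, ← ih]
    push_cast
    ring

theorem two_pow_le_cfDen (d : ℕ → ℕ) (hd : ∀ n, 1 ≤ d n) (n : ℕ) :
    2 ^ n ≤ cfDen d (n + 1) * cfDen d (n + 2) := by
  induction n with
  | zero =>
    have := Nat.mul_le_mul (cfDen_pos d hd 0) (cfDen_pos d hd 1)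
    simpa using this
  | succ n ih =>
    have h1 : cfDen d (n + 2) + cfDen d (n + 1) ≤ cfDen d (n + 3) := by
      have h0 : cfDen d (n + 3) = d (n + 2) * cfDen d (n + 2) + cfDen d (n + 1) := rfl
      have := Nat.mul_le_mul_right (cfDen d (n + 2)) (hd (n + 2))
      omega
    have h2 : cfDen d (n + 1) ≤ cfDen d (n + 2) := by
      have h0 : cfDen d (n + 2) = d (n + 1) * cfDen d (n + 1) + cfDen d n := rfl
      have := Nat.mul_le_mul_right (cfDen d (n + 1)) (hd (n + 1))
      omega
    rw [pow_succ]
    nlinarith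

/-- For positive partial quotients the convergents do converge to `cfValue d`. -/
theorem tendsto_cfValue (d : ℕ → ℕ) (hd : ∀ n, 1 ≤ d n) :
    Tendsto (fun n : ℕ => (cfNum d n : ℝ) / (cfDen d n : ℝ)) atTop (𝓝 (cfValue d)) := by
  have hc : CauchySeq (fun n : ℕ => (cfNum d (n + 1) : ℝ) / (cfDen d (n + 1) : ℝ)) := by
    refine cauchySeq_of_le_geometric (1 / 2) 1 (by norm_num) (fun n => ?_)
    have h1 : (0 : ℝ) < cfDen d (n + 1) := by exact_mod_cast cfDen_pos d hd n
    have h2 : (0 : ℝ) < cfDen d (n + 2) := by exact_mod_cast cfDen_pos d hd (n + 1)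
    have h3 : (2 : ℝ) ^ n ≤ cfDen d (n + 1) * cfDen d (n + 2) := by
      exact_mod_cast two_pow_le_cfDen d hd n
    rw [Real.dist_eq, div_sub_div _ _ h1.ne' h2.ne',
      mul_comm (cfDen d (n + 1) : ℝ) (cfNum d (n + 1 + 1) : ℝ), cf_det d (n + 1),
      abs_div, abs_pow, abs_neg, abs_one, one_pow, abs_of_pos (mul_pos h1 h2), one_mul,
      one_div_pow]
    exact one_div_le_one_div_of_le (by positivity) h3
  obtain ⟨x, hx⟩ := cauchySeq_tendsto_of_complete hc
  have hy : Tendsto (fun n : ℕ => (cfNum d n : ℝ) / (cfDen d n : ℝ)) atTop (𝓝 x) :=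
    (tendsto_add_atTop_iff_nat
      (f := fun n : ℕ => (cfNum d n : ℝ) / (cfDen d n : ℝ)) 1).1 hx
  have hv : cfValue d = x := hy.limUnder_eq
  rw [hv]
  exact hy

/-! ### Perturbed Sudler products -/

/-- `P_{q_n}(α, ε) = ∏_{r = 1}^{q_n} 2 |sin π (r α + (-1)^(n+1) ε / q_n)|` for
`α = [0; d 1, d 2, …]`. -/
def perturbedProd (d : ℕ → ℕ) (n : ℕ) (ε : ℝ) : ℝ :=
  ∏ r ∈ Finset.Icc 1 (cfDen d n),
    2 * |Real.sin (Real.pi *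
      ((r : ℝ) * cfValue d + (-1) ^ (n + 1) * (ε / (cfDen d n : ℝ))))|

/-! ### Purely periodic continued fractions
A period `a_1, …, a_ℓ` is a function on `ZMod ℓ`, i.e. the indices are read modulo `ℓ`. -/

section Periodic

variable {ℓ : ℕ} (a : ZMod ℓ → ℕ)

/-- The partial quotients of `α = [0; a_1, …, a_ℓ, a_1, …, a_ℓ, …]`. -/
def digits (n : ℕ) : ℕ := a (n : ZMod ℓ)

/-- The partial quotients `a_{k-1}, …, a_1, a_ℓ, …, a_k`, repeated, of `α_{σ_k}`:
the `n`-th one is `a_{k-n}`, with the index modulo `ℓ`. -/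
def sigmaDigits (k n : ℕ) : ℕ := a ((k : ZMod ℓ) - (n : ZMod ℓ))

/-- `α_{σ_k}`. -/
def alphaSigma (k : ℕ) : ℝ := cfValue (sigmaDigits a k)

/-- `c = q_{ℓ+1} + p_ℓ`. -/
def cInt : ℕ := cfDen (digits a) (ℓ + 1) + cfNum (digits a) ℓ

/-- The larger root `(c + √(c² + 4 (-1)^(ℓ-1))) / 2`. -/
def rootA : ℝ := ((cInt a : ℝ) + √((cInt a : ℝ) ^ 2 + 4 * (-1) ^ (ℓ - 1))) / 2

/-- The smaller root `(c - √(c² + 4 (-1)^(ℓ-1))) / 2`. -/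
def rootB : ℝ := ((cInt a : ℝ) - √((cInt a : ℝ) ^ 2 + 4 * (-1) ^ (ℓ - 1))) / 2

/-- `c_k = (q_{ℓ+k} - b q_k) / (a - b)` for `0 ≤ k < ℓ`, extended periodically modulo `ℓ`. -/
def cSeq (k : ℕ) : ℝ :=
  ((cfDen (digits a) (ℓ + k % ℓ) : ℝ) - rootB a * (cfDen (digits a) (k % ℓ) : ℝ)) /
    (rootA a - rootB a)

/-- `e_k = (-1)^(k-1) |a q_k - q_{ℓ+k}| / q_ℓ` for `0 ≤ k < ℓ`, extended periodically
modulo `ℓ`; the sign is written `(-1)^(k+1)`, to allow `k = 0`. -/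
def eSeq (k : ℕ) : ℝ :=
  (-1) ^ (k % ℓ + 1) *
    |rootA a * (cfDen (digits a) (k % ℓ) : ℝ) - (cfDen (digits a) (ℓ + k % ℓ) : ℝ)| /
      (cfDen (digits a) ℓ : ℝ)

/-- `|e_k c_k|`. -/
def absEC (k : ℕ) : ℝ := |eSeq a k * cSeq a k|

/-- `u_k(t) = 2 (t / |e_k c_k| - {t α_{σ_k}} + 1/2)`. -/
def u (k t : ℕ) : ℝ :=
  2 * ((t : ℝ) / absEC a k - Int.fract ((t : ℝ) * alphaSigma a k) + 1 / 2)

/-- The `t`-th factor of the infinite product for even `ℓ`. -/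
def factorEven (k : ℕ) (ε : ℝ) (t : ℕ) : ℝ :=
  |1 - (1 + 2 * ε / absEC a k) ^ 2 / u a k t ^ 2| *
    |1 - (1 + 2 / |rootB a| ^ 2) ^ 2 / u a k t ^ 2| ^ (1 / ((cInt a : ℝ) - 2)) *
    ∏ s ∈ Finset.Icc 1 (cInt a - 1),
      |1 - (1 + 2 * (s : ℝ)) ^ 2 / u a k t ^ 2| ^ (-(1 / ((cInt a : ℝ) - 2)))

/-- The factor in front of the infinite product for even `ℓ`. -/
def prefactorEven (k : ℕ) (ε : ℝ) : ℝ :=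
  |1 + ε / absEC a k| * (1 + 1 / |rootB a| ^ 2) ^ (1 / ((cInt a : ℝ) - 2)) *
    (1 / (Nat.factorial (cInt a) : ℝ) ^ (1 / ((cInt a : ℝ) - 2)))

/-- The `t`-th factor of the infinite product for odd `ℓ`. -/
def factorOdd (k : ℕ) (ε : ℝ) (t : ℕ) : ℝ :=
  |1 - (1 + 2 * ε / absEC a k) ^ 2 / u a k t ^ 2| *
    ∏ s ∈ Finset.range (cInt a),
      |1 - (1 + 2 * ((s : ℝ) - 1 / |rootB a|)) ^ 2 / u a k t ^ 2| ^ (-(1 / (cInt a : ℝ)))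

/-- The factor in front of the infinite product for odd `ℓ`. -/
def prefactorOdd (k : ℕ) (ε : ℝ) : ℝ :=
  |1 + ε / absEC a k| /
    ∏ s ∈ Finset.Icc 1 (cInt a), |(s : ℝ) - rootA a| ^ (1 / (cInt a : ℝ))

end Periodic

end Sudler

end

/-!
Write `y_n = |q_n α - p_n|` and `C_n = q_n y_n`. In `P_{q_n}(α, ε)` the last factor is
`2 |sin π (C_n + ε) / q_n|`, and the factors with `r ≡ ± t q_{n-1}` modulo `q_n` combine to
`4 |sin² X_t - sin² Y|`, where `X_t ≈ π C_n u(t) / (2 q_n)` does not depend on `ε` and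
`Y = π (ε + C_n / 2) / q_n` does not depend on `t`. Dividing by `sin² X_t` splits
`P_{q_n}(α, ε)` into a scale `D_n`, independent of `ε`, and a shape whose factors are
`1 + O(t⁻²)` uniformly in `n` (`perturbedProd_eq_scale_mul_shape`). Along `n = m ℓ + k` one has
`C_n → |e_k c_k|` (`tendsto_cfGap`) and `q_{n-1} / q_n → α_{σ_k}` (`tendsto_cfDen_ratio`), so
dominated convergence gives the locally uniform limit of the shape,
`H(ε) = |1 + ε / |e_k c_k|| ∏_t |1 - (1 + 2 ε / |e_k c_k|)² / u_k(t)²|` (`tendsto_sudlerShape`).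

The product of the `sin X_t` converges only conditionally, but its limit need not be computed
directly. Since `q_{n+2ℓ} = c q_{n+ℓ} - (-1)^ℓ q_n`, a Sudler product can be cut into blocks in two
ways, which for even and odd `ℓ` gives, exactly,
`P_{q_n}(0) P_{q_{n+2ℓ}}(a² C_{n+2ℓ}) = ∏_{s<c} P_{q_{n+ℓ}}(s C_{n+ℓ})` and
`P_{q_{n+2ℓ}}(0) = P_{q_n}(0) ∏_{s<c} P_{q_{n+ℓ}}((s - a) C_{n+ℓ})`.
Taking logarithms, `log D_n` satisfies a linear recurrence with characteristic roots `a` and `b`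
whose inhomogeneity converges to a combination of values of `log H`. As `|b| < 1 < a` and
`log D_n = O(log q_n)` (`abs_log_sudlerScale_le`), the growing solution is absent and `log D_n`
converges to the constant solution (`tendsto_of_recurrence`), which is the constant in the asserted
formulas. This needs `H ≠ 0` at the points in question. If `H` vanished at one of them, there
would be an integral linear relation between `1`, `a` and `β = 1 / |e_k c_k| - α_{σ_k}`. Replacing
`a` and `β` by their conjugates `b` and `-α_{σ_k}` (`conjugate_relation`) makes `{t α_{σ_k}}` lie
outside the open interval `(0, 1)`, which is impossible (`limitProd_pos_of_conj`).

Finally `H` is the absolute value on `ℝ` of an entire function (`norm_entireProd`), whence the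
regularity of the limit.
-/

namespace Sudler

/-! ### Continuants and their linear recurrences -/

/-- The signed error `q_n α - p_n` of the `n`-th convergent. -/
noncomputable def cfErr (d : ℕ → ℕ) (n : ℕ) : ℝ := cfDen d n * cfValue d - cfNum d n

/-- The absolute error `|q_n α - p_n|`, written with the sign `(-1)^(n+1)` that the error has, so
that it satisfies algebraic identities; it is shown to be positive in `cfAbsErr_pos`. -/
noncomputable def cfAbsErr (d : ℕ → ℕ) (n : ℕ) : ℝ := (-1) ^ (n + 1) * cfErr d n

/-- `q_n |q_n α - p_n|`. -/
noncomputable def cfGap (d : ℕ → ℕ) (n : ℕ) : ℝ := cfDen d n * cfAbsErr d n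

theorem cfDen_add_two (d : ℕ → ℕ) (n : ℕ) :
    cfDen d (n + 2) = d (n + 1) * cfDen d (n + 1) + cfDen d n := rfl

theorem cfNum_add_two (d : ℕ → ℕ) (n : ℕ) :
    cfNum d (n + 2) = d (n + 1) * cfNum d (n + 1) + cfNum d n := rfl

@[simp] theorem cfDen_zero (d : ℕ → ℕ) : cfDen d 0 = 0 := rfl
@[simp] theorem cfDen_one (d : ℕ → ℕ) : cfDen d 1 = 1 := rfl
@[simp] theorem cfNum_zero (d : ℕ → ℕ) : cfNum d 0 = 1 := rfl
@[simp] theorem cfNum_one (d : ℕ → ℕ) : cfNum d 1 = 0 := rfl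

/-- The solutions of the recurrence `h (i + 1) = d i * h i + h (i - 1)` are the combinations of
numerators and denominators; only the recurrence up to the index `n` is used. -/
theorem recurrence_solution (d : ℕ → ℕ) (h : ℕ → ℝ) (n : ℕ)
    (hh : ∀ i, i + 2 ≤ n → h (i + 2) = d (i + 1) * h (i + 1) + h i) :
    ∀ i, i ≤ n → h i = h 1 * cfDen d i + h 0 * cfNum d i := by
  intro i
  induction i using Nat.twoStepInduction with
  | zero => intro _; simp
  | one => intro _; simp
  | more i h1 h2 =>
    intro hi
    rw [hh i hi, h2 (by omega), h1 (by omega), cfDen_add_two, cfNum_add_two]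
    push_cast
    ring

theorem cfErr_add_two (d : ℕ → ℕ) (n : ℕ) :
    cfErr d (n + 2) = d (n + 1) * cfErr d (n + 1) + cfErr d n := by
  simp only [cfErr, cfDen_add_two, cfNum_add_two]
  push_cast
  ring

theorem cfAbsErr_add_two (d : ℕ → ℕ) (n : ℕ) :
    cfAbsErr d n = d (n + 1) * cfAbsErr d (n + 1) + cfAbsErr d (n + 2) := by
  simp only [cfAbsErr, cfErr_add_two, pow_succ]
  ring

theorem cfDen_mul_cfAbsErr_add (d : ℕ → ℕ) (n : ℕ) :
    cfDen d (n + 1) * cfAbsErr d n + cfDen d n * cfAbsErr d (n + 1) = 1 := by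
  have h := cf_det d n
  have h2 : ((-1 : ℝ) ^ n) * (-1) ^ n = 1 := by rw [← mul_pow]; simp
  simp only [cfAbsErr, cfErr, pow_succ]
  linear_combination (-1 : ℝ) ^ n * h + h2

theorem le_cfDen_succ (d : ℕ → ℕ) (hd : ∀ n, 1 ≤ d n) (n : ℕ) : n ≤ cfDen d (n + 1) := by
  induction n using Nat.twoStepInduction with
  | zero => simp
  | one => exact cfDen_pos d hd 1
  | more n h1 h2 =>
    have h3 := cfDen_pos d hd n
    have h4 := Nat.mul_le_mul_right (cfDen d (n + 2)) (hd (n + 2))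
    have h5 := cfDen_add_two d (n + 1)
    simp only [Nat.add_assoc, Nat.reduceAdd, one_mul] at *
    omega

theorem cfDen_le_succ (d : ℕ → ℕ) (hd : ∀ n, 1 ≤ d n) (n : ℕ) :
    cfDen d n ≤ cfDen d (n + 1) := by
  cases n with
  | zero => simp
  | succ n =>
    have h4 := Nat.mul_le_mul_right (cfDen d (n + 1)) (hd (n + 1))
    have h5 : cfDen d (n + 1 + 1) = _ := cfDen_add_two d n
    omega

theorem cfDen_coprime (d : ℕ → ℕ) (n : ℕ) : Nat.Coprime (cfDen d n) (cfDen d (n + 1)) := by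
  induction n with
  | zero => simp
  | succ n ih =>
    rw [cfDen_add_two]
    simpa using ih.symm

/-- Reading the partial quotients backwards: `q_n / q_{n+1} = [0; d n, …, d 1]`. -/
theorem cfNum_reverse (d d' : ℕ → ℕ) (n : ℕ) (hd : ∀ i, i + 1 ≤ n → d' (i + 1) = d (n - i)) :
    (cfDen d (n + 1) : ℝ) * cfNum d' (n + 1) = cfDen d n * cfDen d' (n + 1) := by
  have h := recurrence_solution d' (fun i => (-1) ^ i * (cfDen d (n + 1 - i) : ℝ)) (n + 1)
    (by
      intro i hi
      obtain ⟨j, rfl⟩ : ∃ j, n = i + 1 + j := ⟨n - (i + 1), by omega⟩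
      rw [hd i (by omega)]
      have e1 : i + 1 + j + 1 - (i + 2) = j := by omega
      have e2 : i + 1 + j + 1 - (i + 1) = j + 1 := by omega
      have e3 : i + 1 + j + 1 - i = j + 2 := by omega
      have e4 : i + 1 + j - i = j + 1 := by omega
      simp only [e1, e2, e3, e4, cfDen_add_two, pow_succ]
      push_cast
      ring) (n + 1) le_rfl
  simp at h
  linear_combination -h

/-! ### Purely periodic expansions -/

section Periodic

variable {ℓ : ℕ} (a : ZMod ℓ → ℕ)

theorem digits_add_period (n : ℕ) : digits a (n + ℓ) = digits a n := by
  simp [digits]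

theorem cfDen_add_period (n : ℕ) :
    (cfDen (digits a) (n + ℓ) : ℝ) =
      cfDen (digits a) (ℓ + 1) * cfDen (digits a) n + cfDen (digits a) ℓ * cfNum (digits a) n := by
  have h := recurrence_solution (digits a) (fun i => (cfDen (digits a) (i + ℓ) : ℝ)) n
    (by
      intro i _
      have e : i + 2 + ℓ = i + ℓ + 2 := by ring
      have e' : i + 1 + ℓ = i + ℓ + 1 := by ring
      simp only [e, e', cfDen_add_two]
      rw [← e', digits_add_period]
      push_cast
      ring) n le_rfl
  simpa [Nat.add_comm 1 ℓ] using h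

theorem cInt_eq : (cInt a : ℝ) = cfDen (digits a) (ℓ + 1) + cfNum (digits a) ℓ := by
  simp [cInt]

theorem cfNum_add_period (n : ℕ) :
    (cfNum (digits a) (n + ℓ) : ℝ) =
      cfNum (digits a) (ℓ + 1) * cfDen (digits a) n + cfNum (digits a) ℓ * cfNum (digits a) n := by
  have h := recurrence_solution (digits a) (fun i => (cfNum (digits a) (i + ℓ) : ℝ)) n
    (by
      intro i _
      have e : i + 2 + ℓ = i + ℓ + 2 := by ring
      have e' : i + 1 + ℓ = i + ℓ + 1 := by ring
      simp only [e, e', cfNum_add_two]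
      rw [← e', digits_add_period]
      push_cast
      ring) n le_rfl
  simpa [Nat.add_comm 1 ℓ] using h

/-- Cayley–Hamilton for the period matrix, which has trace `c` and determinant `(-1)^ℓ`. -/
theorem cfDen_add_two_period (n : ℕ) :
    (cfDen (digits a) (n + ℓ + ℓ) : ℝ) =
      cInt a * cfDen (digits a) (n + ℓ) - (-1) ^ ℓ * cfDen (digits a) n := by
  rw [cfDen_add_period a (n + ℓ), cfNum_add_period, cInt_eq, ← cf_det (digits a) ℓ]
  linear_combination (-(cfNum (digits a) ℓ : ℝ)) * cfDen_add_period a n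

end Periodic

/-! ### The roots of the characteristic polynomial -/

section Roots

variable {ℓ : ℕ} (a : ZMod ℓ → ℕ)

theorem one_le_digits (ha : ∀ j, 1 ≤ a j) (n : ℕ) : 1 ≤ digits a n := ha _

theorem one_le_cInt (ha : ∀ j, 1 ≤ a j) : 1 ≤ cInt a := by
  have := cfDen_pos (digits a) (one_le_digits a ha) ℓ
  unfold cInt
  omega

theorem three_le_cInt (hℓ : 1 ≤ ℓ) (ha : ∀ j, 1 ≤ a j) (he : Even ℓ) : 3 ≤ cInt a := by
  obtain ⟨j, rfl⟩ : ∃ j, ℓ = j + 2 := ⟨ℓ - 2, by obtain ⟨r, hr⟩ := he; omega⟩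
  have h1 := le_cfDen_succ (digits a) (one_le_digits a ha) (j + 2)
  have h2 : ∀ i, 1 ≤ cfNum (digits a) (i + 2) := by
    intro i
    induction i with
    | zero => simp [cfNum]
    | succ i ih =>
      have h4 := Nat.mul_le_mul (one_le_digits a ha (i + 2)) ih
      have h5 := cfNum_add_two (digits a) (i + 1)
      simp only [Nat.add_assoc, Nat.reduceAdd, one_mul] at *
      omega
  have := h2 j
  unfold cInt
  omega

theorem neg_one_pow_pred (hℓ : 1 ≤ ℓ) : (-1 : ℝ) ^ (ℓ - 1) = -(-1) ^ ℓ := by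
  obtain ⟨j, rfl⟩ : ∃ j, ℓ = j + 1 := ⟨ℓ - 1, by omega⟩
  simp [pow_succ]

theorem discr_pos (hℓ : 1 ≤ ℓ) (ha : ∀ j, 1 ≤ a j) :
    0 < (cInt a : ℝ) ^ 2 + 4 * (-1) ^ (ℓ - 1) := by
  rw [neg_one_pow_pred hℓ]
  rcases Nat.even_or_odd ℓ with he | ho
  · have h : (3 : ℝ) ≤ cInt a := by exact_mod_cast three_le_cInt a hℓ ha he
    rw [he.neg_one_pow]
    nlinarith
  · rw [ho.neg_one_pow]
    positivity

theorem rootA_add_rootB : rootA a + rootB a = cInt a := by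
  unfold rootA rootB
  ring

theorem rootA_mul_rootB (hℓ : 1 ≤ ℓ) (ha : ∀ j, 1 ≤ a j) :
    rootA a * rootB a = (-1) ^ ℓ := by
  have h := Real.sq_sqrt (discr_pos a hℓ ha).le
  have h2 := neg_one_pow_pred hℓ
  unfold rootA rootB
  linear_combination (-1 / 4) * h - h2

theorem rootB_lt_rootA (hℓ : 1 ≤ ℓ) (ha : ∀ j, 1 ≤ a j) : rootB a < rootA a := by
  have h := Real.sqrt_pos.2 (discr_pos a hℓ ha)
  unfold rootA rootB
  linarith

theorem one_lt_rootA (hℓ : 1 ≤ ℓ) (ha : ∀ j, 1 ≤ a j) : 1 < rootA a := by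
  have h := Real.sqrt_pos.2 (discr_pos a hℓ ha)
  rcases Nat.even_or_odd ℓ with he | ho
  · have h3 : (3 : ℝ) ≤ cInt a := by exact_mod_cast three_le_cInt a hℓ ha he
    unfold rootA
    linarith
  · have h1 : (1 : ℝ) ≤ cInt a := by exact_mod_cast one_le_cInt a ha
    have h2 : (1 : ℝ) < √((cInt a : ℝ) ^ 2 + 4 * (-1) ^ (ℓ - 1)) := by
      apply Real.lt_sqrt_of_sq_lt
      rw [neg_one_pow_pred hℓ, ho.neg_one_pow]
      nlinarith
    unfold rootA
    linarith

theorem rootB_eq (hℓ : 1 ≤ ℓ) (ha : ∀ j, 1 ≤ a j) : rootB a = (-1) ^ ℓ / rootA a := by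
  have := one_lt_rootA a hℓ ha
  rw [← rootA_mul_rootB a hℓ ha]
  field_simp

theorem abs_rootB (hℓ : 1 ≤ ℓ) (ha : ∀ j, 1 ≤ a j) : |rootB a| = 1 / rootA a := by
  have := one_lt_rootA a hℓ ha
  rw [rootB_eq a hℓ ha, abs_div, abs_pow, abs_neg, abs_one, one_pow, abs_of_pos (by linarith)]

theorem abs_rootB_lt_one (hℓ : 1 ≤ ℓ) (ha : ∀ j, 1 ≤ a j) : |rootB a| < 1 := by
  have := one_lt_rootA a hℓ ha
  rw [abs_rootB a hℓ ha, div_lt_one (by linarith)]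
  exact this

/-! ### Decay of the errors and irrationality -/

/-- The sequence `a q_n - q_{n+ℓ}` is geometric along residue classes modulo `ℓ`. -/
theorem rootA_mul_cfDen_sub_add_period (hℓ : 1 ≤ ℓ) (ha : ∀ j, 1 ≤ a j) (n : ℕ) :
    rootA a * cfDen (digits a) (n + ℓ) - cfDen (digits a) (n + ℓ + ℓ) =
      rootB a * (rootA a * cfDen (digits a) n - cfDen (digits a) (n + ℓ)) := by
  rw [cfDen_add_two_period, ← rootA_mul_rootB a hℓ ha, ← rootA_add_rootB a]
  ring

/-- The identity `a q_n - q_{n+ℓ} = q_ℓ (q_n α - p_n)`: both sides solve the same recurrence, and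
the left side is bounded along `n ∈ ℓ ℕ`, which forces it to be a multiple of the error. -/
theorem rootA_mul_cfDen_sub (hℓ : 1 ≤ ℓ) (ha : ∀ j, 1 ≤ a j) (n : ℕ) :
    rootA a * cfDen (digits a) n - cfDen (digits a) (n + ℓ) =
      cfDen (digits a) ℓ * cfErr (digits a) n := by
  set d := digits a with hd
  have hd1 : ∀ n, 1 ≤ d n := one_le_digits a ha
  set w : ℕ → ℝ := fun n => rootA a * cfDen d n - cfDen d (n + ℓ) with hw
  have hsol : ∀ n, w n = w 1 * cfDen d n + w 0 * cfNum d n := by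
    intro n
    have e0 := cfDen_add_period a n
    have e1 := cfDen_add_period a 1
    have e2 := cfDen_add_period a 0
    rw [← hd] at e0 e1 e2
    simp only [hw, e0, e1, e2]
    simp
    ring
  have hgeo : ∀ m, w (m * ℓ) = rootB a ^ m * w 0 := by
    intro m
    induction m with
    | zero => simp
    | succ m ih =>
      have := rootA_mul_cfDen_sub_add_period a hℓ ha (m * ℓ)
      rw [pow_succ', mul_assoc, ← ih, Nat.succ_mul]
      exact this
  have hq : Tendsto (fun m : ℕ => (cfDen d (m * ℓ) : ℝ)) atTop atTop := by
    refine tendsto_natCast_atTop_atTop.comp (tendsto_atTop_mono (f := fun m => m - 1) ?_ ?_)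
    · intro m
      rcases m with _ | m
      · simp
      · obtain ⟨r, hr⟩ : ∃ r, (m + 1) * ℓ = r + 1 + m := ⟨(m + 1) * ℓ - 1 - m, by
          have := Nat.mul_le_mul_left (m + 1) hℓ
          omega⟩
        have := le_cfDen_succ d hd1 (r + m)
        rw [hr, show r + 1 + m = r + m + 1 by ring]
        omega
    · exact tendsto_sub_atTop_nat 1
  have hlim : Tendsto (fun m : ℕ => w (m * ℓ) / cfDen d (m * ℓ)) atTop (𝓝 0) := by
    have h0 : Tendsto (fun m : ℕ => w (m * ℓ)) atTop (𝓝 0) := by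
      simp only [hgeo]
      simpa using (tendsto_pow_atTop_nhds_zero_of_abs_lt_one
        (abs_rootB_lt_one a hℓ ha)).mul_const (w 0)
    exact h0.div_atTop hq
  have hmul : Tendsto (fun m : ℕ => m * ℓ) atTop atTop :=
    tendsto_atTop_mono (fun m => Nat.le_mul_of_pos_right m hℓ) tendsto_id
  have hlim2 : Tendsto (fun m : ℕ => w (m * ℓ) / cfDen d (m * ℓ)) atTop
      (𝓝 (w 1 + w 0 * cfValue d)) := by
    have h1 := (((tendsto_cfValue d hd1).comp hmul).const_mul (w 0)).const_add (w 1)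
    refine h1.congr' ?_
    filter_upwards [hq.eventually_gt_atTop 0] with m hm
    rw [hsol (m * ℓ)]
    simp only [Function.comp]
    field_simp
  have huniq := tendsto_nhds_unique hlim hlim2
  have hw0 : w 0 = -cfDen d ℓ := by simp [hw]
  change w n = _
  rw [hsol n, cfErr, show w 1 = -(w 0 * cfValue d) by linarith, hw0]
  ring

theorem cfDen_period_pos (hℓ : 1 ≤ ℓ) (ha : ∀ j, 1 ≤ a j) : (0 : ℝ) < cfDen (digits a) ℓ := by
  obtain ⟨j, rfl⟩ : ∃ j, ℓ = j + 1 := ⟨ℓ - 1, by omega⟩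
  exact_mod_cast cfDen_pos (digits a) (one_le_digits a ha) j

theorem cfErr_add_period (hℓ : 1 ≤ ℓ) (ha : ∀ j, 1 ≤ a j) (n : ℕ) :
    cfErr (digits a) (n + ℓ) = rootB a * cfErr (digits a) n := by
  have h := rootA_mul_cfDen_sub_add_period a hℓ ha n
  rw [rootA_mul_cfDen_sub a hℓ ha, rootA_mul_cfDen_sub a hℓ ha] at h
  have := cfDen_period_pos a hℓ ha
  apply mul_left_cancel₀ this.ne'
  linarith

theorem cfAbsErr_add_period (hℓ : 1 ≤ ℓ) (ha : ∀ j, 1 ≤ a j) (n : ℕ) :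
    cfAbsErr (digits a) (n + ℓ) = cfAbsErr (digits a) n / rootA a := by
  have h2 : ((-1 : ℝ) ^ ℓ) * (-1) ^ ℓ = 1 := by rw [← mul_pow]; simp
  rw [cfAbsErr, cfAbsErr, cfErr_add_period a hℓ ha, rootB_eq a hℓ ha,
    show n + ℓ + 1 = n + 1 + ℓ by ring, pow_add]
  linear_combination ((-1) ^ (n + 1) * cfErr (digits a) n / rootA a) * h2

theorem cfAbsErr_mul_period_add (hℓ : 1 ≤ ℓ) (ha : ∀ j, 1 ≤ a j) (k m : ℕ) :
    cfAbsErr (digits a) (m * ℓ + k) = cfAbsErr (digits a) k / rootA a ^ m := by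
  induction m with
  | zero => simp
  | succ m ih =>
    rw [show (m + 1) * ℓ + k = m * ℓ + k + ℓ by ring, cfAbsErr_add_period a hℓ ha, ih, pow_succ,
      div_div]

theorem tendsto_cfAbsErr (hℓ : 1 ≤ ℓ) (ha : ∀ j, 1 ≤ a j) (k : ℕ) :
    Tendsto (fun m : ℕ => cfAbsErr (digits a) (m * ℓ + k)) atTop (𝓝 0) := by
  simp only [cfAbsErr_mul_period_add a hℓ ha]
  exact tendsto_const_nhds.div_atTop (tendsto_pow_atTop_atTop_of_one_lt (one_lt_rootA a hℓ ha))

/-- The convergents alternate around `α`. If the sign were wrong once, the errors of every second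
convergent after it would stay bounded away from `0`, but they decay geometrically. -/
theorem cfAbsErr_pos (hℓ : 1 ≤ ℓ) (ha : ∀ j, 1 ≤ a j) (n : ℕ) : 0 < cfAbsErr (digits a) n := by
  set d := digits a with hd
  have hd1 : ∀ n, 1 ≤ d n := one_le_digits a ha
  by_contra! hn
  have hn0 : 1 ≤ n := by
    rcases n with _ | n
    · simp [cfAbsErr, cfErr] at hn
      linarith
    · omega
  obtain ⟨i, rfl⟩ : ∃ i, n = i + 1 := ⟨n - 1, by omega⟩
  have hi : 0 < cfAbsErr d i := by
    by_contra! hi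
    have h := cfDen_mul_cfAbsErr_add d i
    have h1 := mul_nonpos_of_nonneg_of_nonpos (Nat.cast_nonneg (α := ℝ) (cfDen d (i + 1))) hi
    have h2 := mul_nonpos_of_nonneg_of_nonpos (Nat.cast_nonneg (α := ℝ) (cfDen d i)) hn
    linarith
  have key : ∀ j, cfAbsErr d i ≤ cfAbsErr d (i + 2 * j) ∧ cfAbsErr d (i + 2 * j + 1) ≤ 0 := by
    intro j
    induction j with
    | zero => simpa using hn
    | succ j ih =>
      have e1 := cfAbsErr_add_two d (i + 2 * j)
      have e2 := cfAbsErr_add_two d (i + 2 * j + 1)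
      have g1 : cfAbsErr d i ≤ cfAbsErr d (i + 2 * j + 2) := by
        have := mul_nonpos_of_nonneg_of_nonpos
          (Nat.cast_nonneg (α := ℝ) (d (i + 2 * j + 1))) ih.2
        linarith [ih.1]
      have g2 : (0 : ℝ) ≤ d (i + 2 * j + 1 + 1) * cfAbsErr d (i + 2 * j + 1 + 1) :=
        mul_nonneg (Nat.cast_nonneg _) (hi.le.trans g1)
      exact ⟨g1, show cfAbsErr d (i + 2 * j + 1 + 2) ≤ 0 by linarith [ih.2]⟩
  have hlim := (tendsto_cfAbsErr a hℓ ha i).comp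
    (tendsto_id.const_mul_atTop' (show 0 < 2 by norm_num))
  have : cfAbsErr d i ≤ 0 := by
    refine ge_of_tendsto hlim (Eventually.of_forall fun m => ?_)
    have := (key (m * ℓ)).1
    simp only [Function.comp, id]
    rwa [show 2 * m * ℓ + i = i + 2 * (m * ℓ) by ring]
  linarith

theorem cfGap_pos (hℓ : 1 ≤ ℓ) (ha : ∀ j, 1 ≤ a j) {n : ℕ} (hn : 1 ≤ n) :
    0 < cfGap (digits a) n := by
  obtain ⟨i, rfl⟩ : ∃ i, n = i + 1 := ⟨n - 1, by omega⟩
  have : (0 : ℝ) < cfDen (digits a) (i + 1) := by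
    exact_mod_cast cfDen_pos (digits a) (one_le_digits a ha) i
  exact mul_pos this (cfAbsErr_pos a hℓ ha _)

theorem cfGap_le_one (hℓ : 1 ≤ ℓ) (ha : ∀ j, 1 ≤ a j) (n : ℕ) : cfGap (digits a) n ≤ 1 := by
  have h := cfDen_mul_cfAbsErr_add (digits a) n
  have h1 : (cfDen (digits a) n : ℝ) ≤ cfDen (digits a) (n + 1) := by
    exact_mod_cast cfDen_le_succ (digits a) (one_le_digits a ha) n
  have h2 := mul_le_mul_of_nonneg_right h1 (cfAbsErr_pos a hℓ ha n).le
  have h3 := mul_nonneg (Nat.cast_nonneg (α := ℝ) (cfDen (digits a) n))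
    (cfAbsErr_pos a hℓ ha (n + 1)).le
  unfold cfGap
  linarith

/-- An integer relation `x α = y` is impossible for `x ≠ 0`. -/
theorem eq_zero_of_mul_cfValue_eq (hℓ : 1 ≤ ℓ) (ha : ∀ j, 1 ≤ a j) {x y : ℤ}
    (h : (x : ℝ) * cfValue (digits a) = y) : x = 0 := by
  by_contra hx
  have hx' : (1 : ℝ) ≤ |(x : ℝ)| := by exact_mod_cast Int.one_le_abs hx
  have hlow : ∀ n, 1 ≤ |(x : ℝ)| * cfAbsErr (digits a) n := by
    intro n
    have hp := mul_pos (show 0 < |(x : ℝ)| by linarith) (cfAbsErr_pos a hℓ ha n)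
    have e : |(x : ℝ)| * cfAbsErr (digits a) n =
        |((cfDen (digits a) n * y - x * cfNum (digits a) n : ℤ) : ℝ)| := by
      rw [← abs_of_pos (cfAbsErr_pos a hℓ ha n), ← abs_mul, cfAbsErr, cfErr, ← mul_assoc,
        mul_comm (x : ℝ), mul_assoc, abs_mul, abs_pow, abs_neg, abs_one, one_pow, one_mul]
      push_cast
      rw [← h]
      ring_nf
    rw [e] at hp ⊢
    exact_mod_cast Int.one_le_abs (by rintro h0; rw [h0] at hp; simp at hp)
  have hlim := (tendsto_cfAbsErr a hℓ ha 0).const_mul |(x : ℝ)|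
  rw [mul_zero] at hlim
  have := ge_of_tendsto hlim (Eventually.of_forall fun m => hlow _)
  linarith

end Roots

section Limits

variable {ℓ : ℕ} (a : ZMod ℓ → ℕ)

/-! ### Limits along a residue class modulo the period -/

/-- The component `(q_{n+ℓ} - b q_n) / (a - b)` of `q_n` that grows like a power of `rootA`. -/
noncomputable def cfDenMain (n : ℕ) : ℝ :=
  ((cfDen (digits a) (n + ℓ) : ℝ) - rootB a * cfDen (digits a) n) / (rootA a - rootB a)

theorem cfDenMain_add_period (hℓ : 1 ≤ ℓ) (ha : ∀ j, 1 ≤ a j) (n : ℕ) :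
    cfDenMain a (n + ℓ) = rootA a * cfDenMain a n := by
  rw [cfDenMain, cfDenMain, cfDen_add_two_period, ← rootA_mul_rootB a hℓ ha, ← rootA_add_rootB a]
  ring

theorem cfDen_mono (ha : ∀ j, 1 ≤ a j) : Monotone (cfDen (digits a)) :=
  monotone_nat_of_le_succ (cfDen_le_succ _ (one_le_digits a ha))

theorem cfDenMain_pos (hℓ : 1 ≤ ℓ) (ha : ∀ j, 1 ≤ a j) (n : ℕ) : 0 < cfDenMain a n := by
  have h1 : (cfDen (digits a) n : ℝ) ≤ cfDen (digits a) (n + ℓ) := by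
    exact_mod_cast cfDen_mono a ha (by omega : n ≤ n + ℓ)
  have h2 : (0 : ℝ) < cfDen (digits a) (n + ℓ) :=
    (cfDen_period_pos a hℓ ha).trans_le
      (by exact_mod_cast cfDen_mono a ha (by omega : ℓ ≤ n + ℓ))
  have h3 := abs_rootB_lt_one a hℓ ha
  have h4 : rootB a * cfDen (digits a) n ≤ |rootB a| * cfDen (digits a) (n + ℓ) :=
    mul_le_mul (le_abs_self _) h1 (Nat.cast_nonneg _) (abs_nonneg _)
  refine div_pos ?_ (sub_pos.2 (rootB_lt_rootA a hℓ ha))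
  nlinarith

/-- `c_k` and `e_k` grow and decay at reciprocal rates, so that `|e_k c_k|` may be computed from
any representative of `k` modulo `ℓ`. -/
theorem absEC_eq (hℓ : 1 ≤ ℓ) (ha : ∀ j, 1 ≤ a j) (k : ℕ) :
    absEC a k = cfDenMain a k * cfAbsErr (digits a) k := by
  have hA := one_lt_rootA a hℓ ha
  have hper : ∀ m, cfDenMain a (k % ℓ + ℓ * m) * cfAbsErr (digits a) (k % ℓ + ℓ * m) =
      cfDenMain a (k % ℓ) * cfAbsErr (digits a) (k % ℓ) := by
    intro m
    induction m with
    | zero => simp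
    | succ m ih =>
      rw [mul_add, mul_one, ← add_assoc, cfDenMain_add_period a hℓ ha,
        cfAbsErr_add_period a hℓ ha, ← ih]
      field_simp
  have h := hper (k / ℓ)
  rw [Nat.mod_add_div] at h
  have hq := cfDen_period_pos a hℓ ha
  have hc : cSeq a k = cfDenMain a (k % ℓ) := by rw [cSeq, cfDenMain, Nat.add_comm ℓ]
  have he : |eSeq a k| = cfAbsErr (digits a) (k % ℓ) := by
    rw [eSeq, Nat.add_comm ℓ, rootA_mul_cfDen_sub a hℓ ha, abs_div, abs_mul, abs_pow, abs_neg,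
      abs_one, one_pow, one_mul, abs_abs, abs_mul, abs_of_pos hq, mul_div_cancel_left₀ _ hq.ne',
      ← abs_of_pos (cfAbsErr_pos a hℓ ha (k % ℓ)), cfAbsErr, abs_mul, abs_pow, abs_neg,
      abs_one, one_pow, one_mul]
  rw [h, absEC, abs_mul, hc, he, abs_of_pos (cfDenMain_pos a hℓ ha _), mul_comm]

theorem absEC_pos (hℓ : 1 ≤ ℓ) (ha : ∀ j, 1 ≤ a j) (k : ℕ) : 0 < absEC a k := by
  rw [absEC_eq a hℓ ha]
  exact mul_pos (cfDenMain_pos a hℓ ha k) (cfAbsErr_pos a hℓ ha k)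

theorem absEC_mul_period_add (k m : ℕ) : absEC a (m * ℓ + k) = absEC a k := by
  simp [absEC, eSeq, cSeq]

theorem tendsto_cfGap (hℓ : 1 ≤ ℓ) (ha : ∀ j, 1 ≤ a j) (k : ℕ) :
    Tendsto (fun m : ℕ => cfGap (digits a) (m * ℓ + k)) atTop (𝓝 (absEC a k)) := by
  have hAB := sub_pos.2 (rootB_lt_rootA a hℓ ha)
  have key : ∀ n, |cfGap (digits a) n - absEC a n| ≤
      cfDen (digits a) ℓ / (rootA a - rootB a) * cfAbsErr (digits a) n ^ 2 := by
    intro n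
    have hw := rootA_mul_cfDen_sub a hℓ ha n
    have e : cfGap (digits a) n - absEC a n =
        cfDen (digits a) ℓ / (rootA a - rootB a) *
          (cfErr (digits a) n * cfAbsErr (digits a) n) := by
      rw [absEC_eq a hℓ ha, cfGap, cfDenMain]
      field_simp
      linear_combination cfAbsErr (digits a) n * hw
    have hv : |cfErr (digits a) n| = cfAbsErr (digits a) n := by
      rw [← abs_of_pos (cfAbsErr_pos a hℓ ha n), cfAbsErr, abs_mul, abs_pow, abs_neg, abs_one,
        one_pow, one_mul]
    rw [e, abs_mul, abs_mul, hv, abs_of_pos (cfAbsErr_pos a hℓ ha n), ← sq, abs_of_nonneg]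
    exact div_nonneg (Nat.cast_nonneg _) hAB.le
  rw [tendsto_iff_norm_sub_tendsto_zero]
  have hlim := ((tendsto_cfAbsErr a hℓ ha k).pow 2).const_mul
    (cfDen (digits a) ℓ / (rootA a - rootB a))
  simp only [ne_eq, OfNat.ofNat_ne_zero, not_false_eq_true, zero_pow, mul_zero] at hlim
  refine squeeze_zero (fun _ => norm_nonneg _) (fun m => ?_) hlim
  have := key (m * ℓ + k)
  rwa [absEC_mul_period_add] at this

theorem absEC_le_one (hℓ : 1 ≤ ℓ) (ha : ∀ j, 1 ≤ a j) (k : ℕ) : absEC a k ≤ 1 :=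
  le_of_tendsto (tendsto_cfGap a hℓ ha k) (Eventually.of_forall fun _ => cfGap_le_one a hℓ ha _)

theorem tendsto_mul_period_add (hℓ : 1 ≤ ℓ) (k : ℕ) :
    Tendsto (fun m : ℕ => m * ℓ + k) atTop atTop :=
  tendsto_atTop_mono (fun m => (Nat.le_mul_of_pos_right m hℓ).trans (Nat.le_add_right _ _))
    tendsto_id

theorem tendsto_cfDen_atTop (d : ℕ → ℕ) (hd : ∀ n, 1 ≤ d n) :
    Tendsto (fun n : ℕ => cfDen d n) atTop atTop :=
  (tendsto_add_atTop_iff_nat 1).1 (tendsto_atTop_mono (le_cfDen_succ d hd) tendsto_id)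

theorem tendsto_cfDen_ratio (hℓ : 1 ≤ ℓ) (ha : ∀ j, 1 ≤ a j) (j : ℕ) :
    Tendsto (fun m : ℕ => (cfDen (digits a) (m * ℓ + j) : ℝ) / cfDen (digits a) (m * ℓ + j + 1))
      atTop (𝓝 (alphaSigma a (j + 1))) := by
  have h := (tendsto_cfValue (sigmaDigits a (j + 1)) (fun n => ha _)).comp
    (tendsto_mul_period_add hℓ (j + 1))
  refine h.congr fun m => ?_
  have hr := cfNum_reverse (digits a) (sigmaDigits a (j + 1)) (m * ℓ + j) (by
    intro i hi
    simp only [sigmaDigits, digits]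
    congr 1
    rw [Nat.cast_sub (by omega)]
    simp)
  have h1 : (0 : ℝ) < cfDen (sigmaDigits a (j + 1)) (m * ℓ + j + 1) := by
    exact_mod_cast cfDen_pos (sigmaDigits a (j + 1)) (fun n => ha _) _
  have h2 : (0 : ℝ) < cfDen (digits a) (m * ℓ + j + 1) := by
    exact_mod_cast cfDen_pos (digits a) (fun n => ha _) _
  simp only [Function.comp, ← add_assoc]
  rw [div_eq_div_iff h1.ne' h2.ne']
  linarith

theorem eq_zero_of_mul_alphaSigma_eq (hℓ : 1 ≤ ℓ) (ha : ∀ j, 1 ≤ a j) (k : ℕ) {x y : ℤ}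
    (h : (x : ℝ) * alphaSigma a k = y) : x = 0 :=
  eq_zero_of_mul_cfValue_eq (fun i => a ((k : ZMod ℓ) - i)) hℓ (fun _ => ha _) h

theorem inv_absEC_eq (hℓ : 1 ≤ ℓ) (ha : ∀ j, 1 ≤ a j) (j : ℕ) :
    1 / absEC a (j + 1) =
      alphaSigma a (j + 1) + cfAbsErr (digits a) j / cfAbsErr (digits a) (j + 1) := by
  have hA := one_lt_rootA a hℓ ha
  have h1 : Tendsto (fun m : ℕ => 1 / cfGap (digits a) (m * ℓ + j + 1)) atTop
      (𝓝 (1 / absEC a (j + 1))) :=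
    tendsto_const_nhds.div (tendsto_cfGap a hℓ ha (j + 1)) (absEC_pos a hℓ ha _).ne'
  refine tendsto_nhds_unique h1 (((tendsto_cfDen_ratio a hℓ ha j).add_const _).congr fun m => ?_)
  have hq : (0 : ℝ) < cfDen (digits a) (m * ℓ + j + 1) := by
    exact_mod_cast cfDen_pos (digits a) (fun n => ha _) _
  have hy := cfAbsErr_pos a hℓ ha (m * ℓ + j + 1)
  have e : cfAbsErr (digits a) j / cfAbsErr (digits a) (j + 1) =
      cfAbsErr (digits a) (m * ℓ + j) / cfAbsErr (digits a) (m * ℓ + j + 1) := by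
    rw [add_assoc, cfAbsErr_mul_period_add a hℓ ha, cfAbsErr_mul_period_add a hℓ ha]
    have := pow_pos (show 0 < rootA a by linarith) m
    have := cfAbsErr_pos a hℓ ha (j + 1)
    field_simp
  have hd := cfDen_mul_cfAbsErr_add (digits a) (m * ℓ + j)
  rw [e, cfGap]
  field_simp
  linarith

/-- A form of Galois conjugation, exchanging `rootA` with `rootB` and the complete quotient
`β = 1 / |e_k c_k| - α_{σ_k}` with `-α_{σ_k}`: an integer relation satisfied by `β` holds for the
errors `q_n α - p_n`, hence, `α` being irrational, for the denominators `q_n`. -/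
theorem conjugate_relation (hℓ : 1 ≤ ℓ) (ha : ∀ j, 1 ≤ a j) {k : ℕ} (hk : 1 ≤ k) {t N s r : ℤ}
    (h : (t : ℝ) * (1 / absEC a k - alphaSigma a k) + N = s + r * rootA a) :
    (N : ℝ) - t * alphaSigma a k = s + r * rootB a := by
  obtain ⟨j, rfl⟩ : ∃ j, k = j + 1 := ⟨k - 1, by omega⟩
  have hA := one_lt_rootA a hℓ ha
  have hs : ((-1 : ℝ) ^ ℓ) * (-1) ^ ℓ = 1 := by rw [← mul_pow]; simp
  have hrel : ∀ m : ℕ, -(t : ℝ) * cfDen (digits a) (m * ℓ + ℓ + j) +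
      N * cfDen (digits a) (m * ℓ + ℓ + j + 1) = s * cfDen (digits a) (m * ℓ + ℓ + j + 1) +
        r * (-1) ^ ℓ * cfDen (digits a) (m * ℓ + j + 1) := by
    intro m
    set v := cfErr (digits a) with hv
    have hrel' : -(t : ℝ) * v (m * ℓ + ℓ + j) + N * v (m * ℓ + ℓ + j + 1) =
        s * v (m * ℓ + ℓ + j + 1) + r * (-1) ^ ℓ * v (m * ℓ + j + 1) := by
      rw [inv_absEC_eq a hℓ ha] at h
      have h0 := cfAbsErr_pos a hℓ ha (j + 1)
      have e1 : v (m * ℓ + ℓ + j) =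
          (-1) ^ (m * ℓ + ℓ + j + 1) * (cfAbsErr (digits a) j / rootA a ^ (m + 1)) := by
        rw [← cfAbsErr_mul_period_add a hℓ ha, show (m + 1) * ℓ + j = m * ℓ + ℓ + j by ring,
          cfAbsErr, ← mul_assoc, ← mul_pow]
        simp [hv]
      have e2 : v (m * ℓ + ℓ + j + 1) =
          (-1) ^ (m * ℓ + ℓ + j + 2) * (cfAbsErr (digits a) (j + 1) / rootA a ^ (m + 1)) := by
        rw [← cfAbsErr_mul_period_add a hℓ ha,
          show (m + 1) * ℓ + (j + 1) = m * ℓ + ℓ + j + 1 by ring,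
          cfAbsErr, ← mul_assoc, ← mul_pow]
        simp [hv]
      have e3 : v (m * ℓ + j + 1) = rootA a * (-1) ^ ℓ * v (m * ℓ + ℓ + j + 1) := by
        rw [show m * ℓ + ℓ + j + 1 = m * ℓ + j + 1 + ℓ by ring, hv, cfErr_add_period a hℓ ha,
          rootB_eq a hℓ ha]
        field_simp
        linear_combination -(cfErr (digits a) (m * ℓ + j + 1)) * hs
      have h' : t * cfAbsErr (digits a) j + N * cfAbsErr (digits a) (j + 1) =
          (s + r * rootA a) * cfAbsErr (digits a) (j + 1) := by
        rw [← h]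
        field_simp
        ring
      rw [e3, e1, e2]
      have hp := pow_pos (show 0 < rootA a by linarith) (m + 1)
      field_simp
      simp only [pow_succ (-1 : ℝ) (m * ℓ + ℓ + j + 1)]
      linear_combination (-1 : ℝ) ^ (m * ℓ + ℓ + j + 1) *
        (-h' + r * rootA a * cfAbsErr (digits a) (j + 1) * hs)
    -- By `hrel'` the integers `x` and `y` satisfy `x α = y`, so `x = 0`.
    set x : ℤ := -t * cfDen (digits a) (m * ℓ + ℓ + j) + N * cfDen (digits a) (m * ℓ + ℓ + j + 1) -
      s * cfDen (digits a) (m * ℓ + ℓ + j + 1) -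
        r * (-1) ^ ℓ * cfDen (digits a) (m * ℓ + j + 1) with hx
    set y : ℤ := -t * cfNum (digits a) (m * ℓ + ℓ + j) + N * cfNum (digits a) (m * ℓ + ℓ + j + 1) -
      s * cfNum (digits a) (m * ℓ + ℓ + j + 1) -
        r * (-1) ^ ℓ * cfNum (digits a) (m * ℓ + j + 1) with hy
    have hxy : (x : ℝ) * cfValue (digits a) = y := by
      simp only [hv, cfErr] at hrel'
      rw [hx, hy]
      push_cast
      linear_combination hrel'
    have hx0 := eq_zero_of_mul_cfValue_eq a hℓ ha hxy
    have hx1 : (x : ℝ) = 0 := by rw [hx0]; simp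
    rw [hx] at hx1
    push_cast at hx1
    linarith
  have hqpos : ∀ n : ℕ, (0 : ℝ) < cfDen (digits a) (n + 1) := fun n => by
    exact_mod_cast cfDen_pos (digits a) (fun n => ha _) _
  have hratio : Tendsto (fun m : ℕ => (cfDen (digits a) (m * ℓ + j + 1) : ℝ) /
      cfDen (digits a) (m * ℓ + ℓ + j + 1)) atTop (𝓝 (1 / rootA a)) := by
    have h1 := tendsto_cfGap a hℓ ha (j + 1)
    have h2 := (h1.comp (tendsto_add_atTop_nat 1))
    have h3 := (h1.div h2 (absEC_pos a hℓ ha _).ne').div_const (rootA a)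
    rw [div_self (absEC_pos a hℓ ha _).ne'] at h3
    refine h3.congr fun m => ?_
    have h0 := cfAbsErr_pos a hℓ ha (m * ℓ + j + 1)
    have hq := hqpos (m * ℓ + j + ℓ)
    have e : (m + 1) * ℓ + j + 1 = m * ℓ + j + 1 + ℓ := by ring
    have e' : m * ℓ + ℓ + j + 1 = m * ℓ + j + 1 + ℓ := by ring
    rw [show m * ℓ + j + ℓ + 1 = m * ℓ + j + 1 + ℓ by ring] at hq
    simp only [Function.comp, Pi.div_apply, e, e', cfGap, ← add_assoc]
    rw [cfAbsErr_add_period a hℓ ha]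
    field_simp
  have hlim1 : Tendsto (fun m : ℕ => -(t : ℝ) * ((cfDen (digits a) (m * ℓ + ℓ + j) : ℝ) /
      cfDen (digits a) (m * ℓ + ℓ + j + 1)) + N) atTop
      (𝓝 (-(t : ℝ) * alphaSigma a (j + 1) + N)) := by
    have := ((tendsto_cfDen_ratio a hℓ ha j).comp (tendsto_add_atTop_nat 1))
    refine ((this.const_mul (-(t : ℝ))).add_const (N : ℝ)).congr fun m => ?_
    simp only [Function.comp, Nat.add_mul, one_mul]
  have hlim2 := ((hratio.const_mul ((r : ℝ) * (-1) ^ ℓ)).const_add (s : ℝ))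
  have huniq := tendsto_nhds_unique (hlim1.congr fun m => ?_) hlim2
  · rw [rootB_eq a hℓ ha]
    linear_combination huniq
  · have hq := hqpos (m * ℓ + ℓ + j)
    field_simp
    linarith [hrel m]

end Limits

/-! ### Pairing the factors of a Sudler product -/

theorem abs_sin_of_eq {x y s : ℝ} (hs : s = 1 ∨ s = -1) (k : ℤ) (h : x = s * y + k * Real.pi) :
    |Real.sin x| = |Real.sin y| := by
  rw [h, Real.sin_add_int_mul_pi, abs_mul, abs_zpow, abs_neg, abs_one, one_zpow, one_mul]
  rcases hs with rfl | rfl <;> simp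

/-- Multiplication by a unit permutes the non-zero residues. -/
theorem prod_Ico_mul_mod {q q' : ℕ} (h : Nat.Coprime q' q) (f : ℕ → ℝ) :
    ∏ r ∈ Finset.Ico 1 q, f r = ∏ t ∈ Finset.Ico 1 q, f (t * q' % q) := by
  have hmaps : ∀ t ∈ Finset.Ico 1 q, t * q' % q ∈ Finset.Ico 1 q := by
    intro t ht
    rw [Finset.mem_Ico] at ht ⊢
    refine ⟨Nat.one_le_iff_ne_zero.2 fun h0 => ?_, Nat.mod_lt _ (by omega)⟩
    have := (Nat.Coprime.symm h).dvd_of_dvd_mul_right (Nat.dvd_of_mod_eq_zero h0)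
    have := Nat.le_of_dvd (by omega) this
    omega
  have hinj : Set.InjOn (fun t => t * q' % q) (Finset.Ico 1 q : Set ℕ) := by
    intro s hs t ht hst
    have h1 : s * q' ≡ t * q' [MOD q] := hst
    have h2 : s ≡ t [MOD q] := Nat.ModEq.cancel_right_of_coprime (Nat.Coprime.symm h) h1
    rw [Finset.coe_Ico, Set.mem_Ico] at hs ht
    exact Nat.ModEq.eq_of_lt_of_lt h2 hs.2 ht.2
  rw [← Finset.prod_image (f := f) (g := fun t => t * q' % q) hinj]
  rw [Finset.eq_of_subset_of_card_le (Finset.image_subset_iff.2 hmaps)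
    (Finset.card_image_of_injOn hinj).ge]

/-- The angle `π (t - C {t q'/q} + C/2) / q`: half the difference of the two angles in the
product that belong to a pair of opposite non-zero residues. -/
noncomputable def pairAngle (q q' : ℕ) (C : ℝ) (t : ℕ) : ℝ :=
  Real.pi * (t - C * Int.fract ((t : ℝ) * ((q' : ℝ) / q)) + C / 2) / q

theorem fract_mul_div (q q' t : ℕ) :
    Int.fract ((t : ℝ) * ((q' : ℝ) / q)) = ((t * q' % q : ℕ) : ℝ) / q := by
  rw [← Int.fract_div_natCast_eq_div_natCast_mod]
  push_cast
  rw [mul_div_assoc]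

/-- The factors of the product, reordered by `r ≡ t q_{n-1}` modulo `q_n`, for which
`r p_n / q_n ≡ ± t / q_n` modulo `1`. The first factor is the one with `r = q_n`. -/
theorem perturbedProd_eq (d : ℕ → ℕ) (hd : ∀ n, 1 ≤ d n) (n : ℕ) (ε : ℝ) :
    perturbedProd d (n + 1) ε =
      2 * |Real.sin (Real.pi * (cfGap d (n + 1) + ε) / cfDen d (n + 1))| *
        ∏ t ∈ Finset.Ico 1 (cfDen d (n + 1)),
          2 * |Real.sin (pairAngle (cfDen d (n + 1)) (cfDen d n) (cfGap d (n + 1)) t -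
            Real.pi * (ε + cfGap d (n + 1) / 2) / cfDen d (n + 1))| := by
  have hq1 := cfDen_pos d hd n
  have hdet := cf_det d n
  have hcop := cfDen_coprime d n
  have hs2 : ((-1 : ℝ) ^ n) * (-1) ^ n = 1 := by rw [← mul_pow]; simp
  have hs := neg_one_pow_eq_or ℝ n
  have hs' : -(-1 : ℝ) ^ n = 1 ∨ -(-1 : ℝ) ^ n = -1 := by
    rcases hs with h | h <;> simp [h]
  have hgap : cfGap d (n + 1) =
      cfDen d (n + 1) * ((-1) ^ n * (cfDen d (n + 1) * cfValue d - cfNum d (n + 1))) := by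
    simp [cfGap, cfAbsErr, cfErr, pow_succ]
  set q := cfDen d (n + 1) with hq
  have hqpos : (0 : ℝ) < q := by exact_mod_cast hq1
  set C := cfGap d (n + 1) with hC
  have hα : cfValue d = cfNum d (n + 1) / q + (-1) ^ n * C / q ^ 2 := by
    rw [hgap]
    field_simp
    linear_combination (-(q * cfValue d - cfNum d (n + 1))) * hs2
  rw [perturbedProd, ← Finset.Ico_insert_right hq1, Finset.prod_insert Finset.right_notMem_Ico]
  congr 1
  · congr 1
    refine abs_sin_of_eq hs (cfNum d (n + 1)) ?_
    rw [← hq, hα]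
    simp only [pow_succ]
    push_cast
    field_simp
    ring
  · rw [prod_Ico_mul_mod hcop]
    refine Finset.prod_congr rfl fun t ht => ?_
    congr 1
    refine abs_sin_of_eq hs' (t * cfNum d n - (t * cfDen d n / q : ℕ) * cfNum d (n + 1)) ?_
    have hmod : (t : ℝ) * cfDen d n = q * (t * cfDen d n / q : ℕ) + (t * cfDen d n % q : ℕ) := by
      exact_mod_cast (Nat.div_add_mod (t * cfDen d n) q).symm
    rw [pairAngle, fract_mul_div, hα]
    generalize t * cfDen d n % q = r at hmod ⊢
    generalize t * cfDen d n / q = e at hmod ⊢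
    rw [← hq]
    simp only [pow_succ]
    push_cast
    field_simp
    linear_combination (-2 * cfNum d (n + 1) * q) * hmod - 2 * t * q * hdet

theorem pairAngle_reflect {q q' : ℕ} (h : Nat.Coprime q' q) (C : ℝ) {t : ℕ} (ht : 1 ≤ t)
    (htq : t < q) : pairAngle q q' C (q - t) = Real.pi - pairAngle q q' C t := by
  have hq : (0 : ℝ) < q := by exact_mod_cast (by omega : 0 < q)
  have hne : Int.fract ((t : ℝ) * ((q' : ℝ) / q)) ≠ 0 := by
    rw [fract_mul_div]
    refine div_ne_zero (Nat.cast_ne_zero.2 fun h0 => ?_) hq.ne'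
    have := (Nat.Coprime.symm h).dvd_of_dvd_mul_right (Nat.dvd_of_mod_eq_zero h0)
    have := Nat.le_of_dvd (by omega) this
    omega
  have hfr : Int.fract (((q - t : ℕ) : ℝ) * ((q' : ℝ) / q)) =
      1 - Int.fract ((t : ℝ) * ((q' : ℝ) / q)) := by
    rw [← Int.fract_neg hne, Nat.cast_sub htq.le,
      show ((q : ℝ) - t) * ((q' : ℝ) / q) = -(t * ((q' : ℝ) / q)) + (q' : ℕ) by field_simp; ring,
      Int.fract_add_natCast]
  rw [pairAngle, pairAngle, hfr, Nat.cast_sub htq.le]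
  field_simp
  ring

theorem pairAngle_bounds {q q' : ℕ} (hq : 1 ≤ q) {C : ℝ} (hC : 0 < C) (hC1 : C ≤ 1) (t : ℕ) :
    Real.pi * (t - 1 / 2) / q ≤ pairAngle q q' C t ∧
      pairAngle q q' C t ≤ Real.pi * (t + 1 / 2) / q := by
  have hq : (0 : ℝ) < q := by exact_mod_cast hq
  have h0 := Int.fract_nonneg ((t : ℝ) * ((q' : ℝ) / q))
  have h1 := Int.fract_lt_one ((t : ℝ) * ((q' : ℝ) / q))
  have hp := Real.pi_pos
  unfold pairAngle
  constructor <;> gcongr <;> nlinarith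

theorem sin_lower_bound {q t : ℕ} (ht : 1 ≤ t) (htq : 2 * t ≤ q) {x : ℝ}
    (h1 : Real.pi * (t - 1 / 2) / q ≤ x) (h2 : x ≤ Real.pi * (t + 1 / 2) / q) :
    (t : ℝ) / q ≤ Real.sin x := by
  have hq : (0 : ℝ) < q := by exact_mod_cast (by omega : 0 < q)
  have ht' : (1 : ℝ) ≤ t := by exact_mod_cast ht
  have htq' : 2 * (t : ℝ) ≤ q := by exact_mod_cast htq
  have hp := Real.pi_pos
  have key : ∀ y, Real.pi * (t - 1 / 2) / q ≤ y → y ≤ Real.pi / 2 → (t : ℝ) / q ≤ Real.sin y := by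
    intro y hy1 hy2
    have hy0 : 0 ≤ y := le_trans (by apply div_nonneg _ hq.le; nlinarith) hy1
    refine le_trans ?_ (Real.mul_le_sin hy0 hy2)
    refine le_trans ?_ (mul_le_mul_of_nonneg_left hy1 (by positivity))
    rw [show 2 / Real.pi * (Real.pi * (t - 1 / 2) / q) = (2 * t - 1) / q by field_simp]
    gcongr
    linarith
  rcases le_total x (Real.pi / 2) with hx | hx
  · exact key x h1 hx
  · rw [← Real.sin_pi_sub]
    refine key _ ?_ (by linarith)
    have : Real.pi * (t - 1 / 2) / q ≤ Real.pi - Real.pi * (t + 1 / 2) / q := by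
      rw [le_sub_iff_add_le, ← add_div, div_le_iff₀ hq]
      nlinarith
    linarith

theorem sin_pairAngle_pos {q q' : ℕ} {C : ℝ} (hC : 0 < C) (hC1 : C ≤ 1) {t : ℕ} (ht : 1 ≤ t)
    (htq : t < q) : 0 < Real.sin (pairAngle q q' C t) := by
  have hq : (0 : ℝ) < q := by exact_mod_cast (by omega : 0 < q)
  have ht' : (1 : ℝ) ≤ t := by exact_mod_cast ht
  have htq' : (t : ℝ) + 1 ≤ q := by exact_mod_cast htq
  obtain ⟨h1, h2⟩ := pairAngle_bounds (q' := q') (by omega : 1 ≤ q) hC hC1 t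
  have hp := Real.pi_pos
  refine Real.sin_pos_of_pos_of_lt_pi (lt_of_lt_of_le ?_ h1) (lt_of_le_of_lt h2 ?_)
  · apply div_pos _ hq
    nlinarith
  · rw [div_lt_iff₀ hq]
    nlinarith

/-- The effect of the perturbation `ε` on the pair of factors with index `t`, relative to
`ε = -C/2`. -/
noncomputable def pairRatio (q q' : ℕ) (C ε : ℝ) (t : ℕ) : ℝ :=
  |1 - Real.sin (Real.pi * (ε + C / 2) / q) ^ 2 / Real.sin (pairAngle q q' C t) ^ 2|

theorem pairRatio_reflect {q q' : ℕ} (h : Nat.Coprime q' q) (C ε : ℝ) {t : ℕ} (ht : 1 ≤ t)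
    (htq : t < q) : pairRatio q q' C ε (q - t) = pairRatio q q' C ε t := by
  rw [pairRatio, pairAngle_reflect h C ht htq, Real.sin_pi_sub, pairRatio]

theorem sin_sub_mul_sin_add (x y : ℝ) :
    Real.sin (x - y) * Real.sin (x + y) = Real.sin x ^ 2 - Real.sin y ^ 2 := by
  rw [Real.sin_sub, Real.sin_add]
  linear_combination Real.sin x ^ 2 * (Real.sin_sq_add_cos_sq y) -
    Real.sin y ^ 2 * (Real.sin_sq_add_cos_sq x)

theorem prod_Ico_one_reflect (q : ℕ) (f : ℕ → ℝ) :
    ∏ t ∈ Finset.Ico 1 q, f (q - t) = ∏ t ∈ Finset.Ico 1 q, f t := by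
  refine Finset.prod_nbij' (fun t => q - t) (fun t => q - t) ?_ ?_ ?_ ?_ ?_ <;>
    intro t ht <;> simp only [Finset.mem_Ico] at ht ⊢ <;> first | rfl | omega

/-- Squaring the product allows every factor to be paired with the one of the opposite residue,
without treating the residue `q/2` separately. -/
theorem prod_sq_eq {q q' : ℕ} (h : Nat.Coprime q' q) {C : ℝ} (hC : 0 < C) (hC1 : C ≤ 1) (ε : ℝ) :
    (∏ t ∈ Finset.Ico 1 q,
      2 * |Real.sin (pairAngle q q' C t - Real.pi * (ε + C / 2) / q)|) ^ 2 =
      (∏ t ∈ Finset.Ico 1 q, 2 * Real.sin (pairAngle q q' C t)) ^ 2 *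
        ∏ t ∈ Finset.Ico 1 q, pairRatio q q' C ε t := by
  set y := Real.pi * (ε + C / 2) / q with hy
  have hF := prod_Ico_one_reflect q (fun t => 2 * |Real.sin (pairAngle q q' C t - y)|)
  beta_reduce at hF
  rw [sq]
  nth_rewrite 2 [← hF]
  rw [← Finset.prod_mul_distrib, sq, ← Finset.prod_mul_distrib, ← Finset.prod_mul_distrib]
  refine Finset.prod_congr rfl fun t ht => ?_
  rw [Finset.mem_Ico] at ht
  have hpos := sin_pairAngle_pos (q' := q') hC hC1 ht.1 ht.2
  have e2 : |Real.sin (Real.pi - pairAngle q q' C t - y)| =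
      |Real.sin (pairAngle q q' C t + y)| := by
    rw [show Real.pi - pairAngle q q' C t - y = Real.pi - (pairAngle q q' C t + y) by ring,
      Real.sin_pi_sub]
  have e3 : |Real.sin (pairAngle q q' C t) ^ 2 - Real.sin y ^ 2| =
      Real.sin (pairAngle q q' C t) ^ 2 * pairRatio q q' C ε t := by
    rw [pairRatio, ← hy, ← abs_of_pos (pow_pos hpos 2), ← abs_mul, abs_of_pos (pow_pos hpos 2)]
    congr 1
    field_simp
  rw [pairAngle_reflect h C ht.1 ht.2, e2]
  rw [← sin_sub_mul_sin_add, abs_mul] at e3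
  linear_combination 4 * e3

/-- The product of the ratios over the pairs `{t, q - t}`; in the first of the two versions
the index `t = q / 2` is included. -/
theorem prod_pairRatio {q q' : ℕ} (h : Nat.Coprime q' q) (hq : 1 ≤ q) (C ε : ℝ) :
    ∏ t ∈ Finset.Ico 1 q, pairRatio q q' C ε t =
      (∏' i : ℕ, (1 + if 2 * (i + 1) ≤ q then pairRatio q q' C ε (i + 1) - 1 else 0)) *
        ∏' i : ℕ, (1 + if 2 * (i + 1) < q then pairRatio q q' C ε (i + 1) - 1 else 0) := by
  obtain ⟨p, rfl⟩ : ∃ p, q = p + 1 := ⟨q - 1, by omega⟩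
  rw [tprod_eq_prod (s := Finset.range p) (fun i hi => by
      rw [Finset.mem_range] at hi; rw [if_neg (by omega), add_zero]),
    tprod_eq_prod (s := Finset.range p) (fun i hi => by
      rw [Finset.mem_range] at hi; rw [if_neg (by omega), add_zero]),
    ← Finset.prod_range_reflect (fun i => (1 + if 2 * (i + 1) < p + 1 then _ else 0)),
    ← Finset.prod_mul_distrib, Finset.prod_Ico_eq_prod_range]
  refine Finset.prod_congr (by simp) fun i hi => ?_
  rw [Finset.mem_range] at hi
  have hr := pairRatio_reflect h C ε (t := i + 1) (by omega) (by omega)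
  rw [show p + 1 - (i + 1) = p - 1 - i + 1 by omega] at hr
  rw [hr, Nat.add_comm 1 i]
  by_cases h2 : 2 * (i + 1) ≤ p + 1
  · rw [if_pos h2, if_neg (by omega)]
    ring
  · rw [if_neg h2, if_pos (by omega)]
    ring

/-! ### The limit of the normalised products -/

/-- `2 (t / C - {t θ} + 1/2)`, which is `u_k(t)` for `C = |e_k c_k|` and `θ = α_{σ_k}`. -/
noncomputable def shiftedArg (C θ : ℝ) (t : ℕ) : ℝ :=
  2 * ((t : ℝ) / C - Int.fract ((t : ℝ) * θ) + 1 / 2)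

/-- The infinite product `∏_{t ≥ 1} |1 - s² / u(t)²|` with `u = shiftedArg C θ`. -/
noncomputable def limitProd (C θ s : ℝ) : ℝ :=
  ∏' i : ℕ, |1 - s ^ 2 / shiftedArg C θ (i + 1) ^ 2|

theorem shiftedArg_pos {C : ℝ} (hC : 0 < C) (hC1 : C ≤ 1) (θ : ℝ) {t : ℕ} (ht : 1 ≤ t) :
    (t : ℝ) - 1 / 2 < shiftedArg C θ t := by
  have h1 := Int.fract_lt_one ((t : ℝ) * θ)
  have ht' : (1 : ℝ) ≤ t := by exact_mod_cast ht
  have h2 : (t : ℝ) ≤ t / C := by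
    rw [le_div_iff₀ hC]
    nlinarith
  unfold shiftedArg
  linarith

theorem summable_div_shiftedArg_sq {C : ℝ} (hC : 0 < C) (hC1 : C ≤ 1) (θ s : ℝ) :
    Summable (fun i : ℕ => s ^ 2 / shiftedArg C θ (i + 1) ^ 2) := by
  have h := ((summable_nat_add_iff 1).2 (Real.summable_one_div_nat_pow.2 one_lt_two)).mul_left
    (4 * s ^ 2)
  refine Summable.of_nonneg_of_le (fun i => by positivity) (fun i => ?_) h
  have h1 := shiftedArg_pos hC hC1 θ (show 1 ≤ i + 1 by omega)
  push_cast at h1 ⊢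
  have h2 : ((i : ℝ) + 1) / 2 ≤ shiftedArg C θ (i + 1) := by
    have : (0 : ℝ) ≤ i := Nat.cast_nonneg i
    linarith
  have h3 : (((i : ℝ) + 1) / 2) ^ 2 ≤ shiftedArg C θ (i + 1) ^ 2 :=
    pow_le_pow_left₀ (by positivity) h2 2
  calc s ^ 2 / shiftedArg C θ (i + 1) ^ 2 ≤ s ^ 2 / (((i : ℝ) + 1) / 2) ^ 2 := by gcongr
    _ = 4 * s ^ 2 * (1 / ((i : ℝ) + 1) ^ 2) := by field_simp; norm_num

theorem tendsto_mul_sin_div {ι : Type*} {l : Filter ι} {q : ι → ℕ} {y : ι → ℝ} {y₀ : ℝ}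
    (hq : Tendsto q l atTop) (hy : Tendsto y l (𝓝 y₀)) :
    Tendsto (fun m => (q m : ℝ) * Real.sin (y m / q m)) l (𝓝 y₀) := by
  have hq' : Tendsto (fun m => (q m : ℝ)) l atTop := tendsto_natCast_atTop_atTop.comp hq
  have h1 : Tendsto (fun m => y m * Real.sinc (y m / q m)) l (𝓝 (y₀ * Real.sinc 0)) :=
    hy.mul ((Real.continuous_sinc.tendsto 0).comp (hy.div_atTop hq'))
  rw [Real.sinc_zero, mul_one] at h1
  refine h1.congr' ?_
  filter_upwards [hq'.eventually_gt_atTop 0] with m hm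
  rcases eq_or_ne (y m) 0 with h0 | h0
  · simp [h0]
  · rw [Real.sinc_of_ne_zero (div_ne_zero h0 hm.ne')]
    field_simp

/-- Dominated convergence for the products over pairs. The condition `P m i` restricts the `m`-th
product to indices `i + 1 ≤ q m / 2`, where the sine of the pair angle is of order `(i + 1) / q m`,
so that the factors are `1 + O(1 / (i + 1)^2)`. -/
theorem tendsto_tprod_pairRatio {ι : Type*} {l : Filter ι} {q q' : ι → ℕ} {C ε : ι → ℝ}
    {C₀ ε₀ θ : ℝ} (hq : Tendsto q l atTop) (hC : Tendsto C l (𝓝 C₀)) (hC₀ : 0 < C₀)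
    (hCpos : ∀ m, 0 < C m) (hC1 : ∀ m, C m ≤ 1) (hε : Tendsto ε l (𝓝 ε₀))
    (hθ : Tendsto (fun m => (q' m : ℝ) / q m) l (𝓝 θ))
    (hirr : ∀ t : ℕ, 1 ≤ t → ∀ z : ℤ, (t : ℝ) * θ ≠ z)
    (P : ι → ℕ → Prop) [∀ m, DecidablePred (P m)] (hP : ∀ i, ∀ᶠ m in l, P m i)
    (hP2 : ∀ m i, P m i → 2 * (i + 1) ≤ q m) :
    Tendsto (fun m => ∏' i : ℕ,
      (1 + if P m i then pairRatio (q m) (q' m) (C m) (ε m) (i + 1) - 1 else 0)) l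
      (𝓝 (limitProd C₀ θ (1 + 2 * ε₀ / C₀))) := by
  rcases eq_or_neBot l with rfl | _
  · simp
  have hq' : Tendsto (fun m => (q m : ℝ)) l atTop := tendsto_natCast_atTop_atTop.comp hq
  have hC₀1 : C₀ ≤ 1 := le_of_tendsto hC (Eventually.of_forall hC1)
  have hlim : limitProd C₀ θ (1 + 2 * ε₀ / C₀) = ∏' i : ℕ,
      (1 + (|1 - (1 + 2 * ε₀ / C₀) ^ 2 / shiftedArg C₀ θ (i + 1) ^ 2| - 1)) := by
    simp [limitProd]
  rw [hlim]
  have hp := Real.pi_pos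
  refine tendsto_tprod_one_add_of_dominated_convergence
    (bound := fun i : ℕ => (Real.pi * (|ε₀| + 2)) ^ 2 * (1 / ((i + 1 : ℕ) : ℝ) ^ 2))
    (((summable_nat_add_iff 1).2 (Real.summable_one_div_nat_pow.2 one_lt_two)).mul_left _) ?_ ?_
  · intro i
    have hlim2 : Tendsto (fun m => pairRatio (q m) (q' m) (C m) (ε m) (i + 1)) l
        (𝓝 (|1 - (1 + 2 * ε₀ / C₀) ^ 2 / shiftedArg C₀ θ (i + 1) ^ 2|)) := by
      have hU : 0 < shiftedArg C₀ θ (i + 1) := by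
        have := shiftedArg_pos hC₀ hC₀1 θ (show 1 ≤ i + 1 by omega)
        push_cast at this
        have : (0 : ℝ) ≤ i := Nat.cast_nonneg i
        linarith
      have hfract : Tendsto (fun m => Int.fract (((i + 1 : ℕ) : ℝ) * ((q' m : ℝ) / q m))) l
          (𝓝 (Int.fract (((i + 1 : ℕ) : ℝ) * θ))) :=
        ((continuousAt_fract (hirr (i + 1) (by omega) _)).tendsto).comp (hθ.const_mul _)
      have hY := tendsto_mul_sin_div hq ((hε.add (hC.div_const 2)).const_mul Real.pi)
      have hX := tendsto_mul_sin_div hq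
        ((((hC.mul hfract).const_sub ((i + 1 : ℕ) : ℝ)).add (hC.div_const 2)).const_mul Real.pi)
      have hXU : Real.pi * (((i + 1 : ℕ) : ℝ) - C₀ * Int.fract (((i + 1 : ℕ) : ℝ) * θ) + C₀ / 2) =
          Real.pi * (C₀ / 2) * shiftedArg C₀ θ (i + 1) := by
        unfold shiftedArg
        field_simp
      rw [hXU] at hX
      have hne : (Real.pi * (C₀ / 2) * shiftedArg C₀ θ (i + 1)) ^ 2 ≠ 0 := by positivity
      have h := (((hY.pow 2).div (hX.pow 2) hne).const_sub 1).abs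
      have hval : (Real.pi * (ε₀ + C₀ / 2)) ^ 2 /
          (Real.pi * (C₀ / 2) * shiftedArg C₀ θ (i + 1)) ^ 2 =
          (1 + 2 * ε₀ / C₀) ^ 2 / shiftedArg C₀ θ (i + 1) ^ 2 := by
        field_simp
        ring
      rw [hval] at h
      refine h.congr' ?_
      filter_upwards [hq'.eventually_gt_atTop 0] with m hm
      simp only [Pi.div_apply, mul_pow]
      rw [mul_div_mul_left _ _ (pow_ne_zero 2 hm.ne')]
      rfl
    refine (hlim2.sub_const 1).congr' ?_
    filter_upwards [hP i] with m hm
    rw [if_pos hm]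
  · filter_upwards [hε.abs.eventually_le_const (show |ε₀| < |ε₀| + 1 by linarith),
      hq'.eventually_gt_atTop 0] with m hm hqm i
    by_cases hPi : P m i
    swap
    · rw [if_neg hPi, norm_zero]
      positivity
    rw [if_pos hPi, Real.norm_eq_abs]
    have hqm1 : 1 ≤ q m := by exact_mod_cast hqm
    obtain ⟨b1, b2⟩ := pairAngle_bounds (q' := q' m) hqm1 (hCpos m) (hC1 m) (i + 1)
    have hsin := sin_lower_bound (show 1 ≤ i + 1 by omega) (hP2 m i hPi) b1 b2
    have hi : (0 : ℝ) < ((i + 1 : ℕ) : ℝ) := by positivity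
    have habs : |Real.sin (Real.pi * (ε m + C m / 2) / q m)| ≤ Real.pi * (|ε₀| + 2) / q m := by
      refine Real.abs_sin_le_abs.trans ?_
      rw [abs_div, abs_mul, abs_of_pos hp, abs_of_pos hqm]
      gcongr
      refine (abs_add_le _ _).trans ?_
      rw [abs_of_pos (show 0 < C m / 2 by linarith [hCpos m])]
      linarith [hC1 m]
    unfold pairRatio
    set z := Real.sin (Real.pi * (ε m + C m / 2) / q m) ^ 2 /
      Real.sin (pairAngle (q m) (q' m) (C m) (i + 1)) ^ 2 with hz
    have h1 : |(|1 - z|) - 1| ≤ |z| := by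
      have := abs_abs_sub_abs_le_abs_sub (1 - z) 1
      simpa using this
    refine h1.trans ?_
    rw [abs_of_nonneg (by positivity), hz, ← sq_abs (Real.sin (Real.pi * _ / _))]
    calc |Real.sin (Real.pi * (ε m + C m / 2) / q m)| ^ 2 /
          Real.sin (pairAngle (q m) (q' m) (C m) (i + 1)) ^ 2
        ≤ (Real.pi * (|ε₀| + 2) / q m) ^ 2 / (((i + 1 : ℕ) : ℝ) / q m) ^ 2 := by gcongr
      _ = (Real.pi * (|ε₀| + 2)) ^ 2 * (1 / ((i + 1 : ℕ) : ℝ) ^ 2) := by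
        field_simp

/-- The part of a perturbed Sudler product that does not depend on the perturbation. -/
noncomputable def sudlerScale (q q' : ℕ) (C : ℝ) : ℝ :=
  2 * Real.pi * C / q * ∏ t ∈ Finset.Ico 1 q, 2 * Real.sin (pairAngle q q' C t)

/-- The part of a perturbed Sudler product that depends on the perturbation. The square root
makes up for the fact that every pair is counted twice. -/
noncomputable def sudlerShape (q q' : ℕ) (C ε : ℝ) : ℝ :=
  |Real.sin (Real.pi * (C + ε) / q)| / (Real.pi * C / q) *
    √((∏' i : ℕ, (1 + if 2 * (i + 1) ≤ q then pairRatio q q' C ε (i + 1) - 1 else 0)) *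
      ∏' i : ℕ, (1 + if 2 * (i + 1) < q then pairRatio q q' C ε (i + 1) - 1 else 0))

theorem sudlerScale_pos {q q' : ℕ} (hq : 1 ≤ q) {C : ℝ} (hC : 0 < C) (hC1 : C ≤ 1) :
    0 < sudlerScale q q' C := by
  have hq' : (0 : ℝ) < q := by exact_mod_cast hq
  refine mul_pos (by have := Real.pi_pos; positivity) (Finset.prod_pos fun t ht => ?_)
  rw [Finset.mem_Ico] at ht
  exact mul_pos two_pos (sin_pairAngle_pos hC hC1 ht.1 ht.2)

theorem perturbedProd_eq_scale_mul_shape (d : ℕ → ℕ) (hd : ∀ n, 1 ≤ d n) (n : ℕ)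
    (hC : 0 < cfGap d (n + 1)) (hC1 : cfGap d (n + 1) ≤ 1) (ε : ℝ) :
    perturbedProd d (n + 1) ε =
      sudlerScale (cfDen d (n + 1)) (cfDen d n) (cfGap d (n + 1)) *
        sudlerShape (cfDen d (n + 1)) (cfDen d n) (cfGap d (n + 1)) ε := by
  have hq1 := cfDen_pos d hd n
  have hcop := cfDen_coprime d n
  have hp := Real.pi_pos
  rw [perturbedProd_eq d hd, sudlerShape, ← prod_pairRatio hcop hq1, sudlerScale]
  set q := cfDen d (n + 1)
  set C := cfGap d (n + 1)
  have hq' : (0 : ℝ) < q := by exact_mod_cast hq1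
  have hsq := prod_sq_eq hcop hC hC1 ε
  set F := ∏ t ∈ Finset.Ico 1 q,
    2 * |Real.sin (pairAngle q (cfDen d n) C t - Real.pi * (ε + C / 2) / q)|
  have hF : 0 ≤ F := Finset.prod_nonneg fun t _ => by positivity
  have hB : 0 ≤ ∏ t ∈ Finset.Ico 1 q, 2 * Real.sin (pairAngle q (cfDen d n) C t) :=
    Finset.prod_nonneg fun t ht => by
      rw [Finset.mem_Ico] at ht
      exact (mul_pos two_pos (sin_pairAngle_pos hC hC1 ht.1 ht.2)).le
  rw [show F = √(F ^ 2) from (Real.sqrt_sq hF).symm, hsq, Real.sqrt_mul (sq_nonneg _),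
    Real.sqrt_sq hB]
  field_simp

theorem limitProd_nonneg (C θ s : ℝ) : 0 ≤ limitProd C θ s := tprod_nonneg fun _ => abs_nonneg _

theorem tendsto_sudlerShape {ι : Type*} {l : Filter ι} {q q' : ι → ℕ} {C ε : ι → ℝ}
    {C₀ ε₀ θ : ℝ} (hq : Tendsto q l atTop) (hC : Tendsto C l (𝓝 C₀)) (hC₀ : 0 < C₀)
    (hCpos : ∀ m, 0 < C m) (hC1 : ∀ m, C m ≤ 1) (hε : Tendsto ε l (𝓝 ε₀))
    (hθ : Tendsto (fun m => (q' m : ℝ) / q m) l (𝓝 θ))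
    (hirr : ∀ t : ℕ, 1 ≤ t → ∀ z : ℤ, (t : ℝ) * θ ≠ z) :
    Tendsto (fun m => sudlerShape (q m) (q' m) (C m) (ε m)) l
      (𝓝 (|1 + ε₀ / C₀| * limitProd C₀ θ (1 + 2 * ε₀ / C₀))) := by
  have hq' : Tendsto (fun m => (q m : ℝ)) l atTop := tendsto_natCast_atTop_atTop.comp hq
  have hp := Real.pi_pos
  have h1 := tendsto_tprod_pairRatio hq hC hC₀ hCpos hC1 hε hθ hirr
    (fun m i => 2 * (i + 1) ≤ q m) (fun i => hq.eventually_ge_atTop _) (fun m i h => h)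
  have h2 := tendsto_tprod_pairRatio hq hC hC₀ hCpos hC1 hε hθ hirr
    (fun m i => 2 * (i + 1) < q m) (fun i => hq.eventually_gt_atTop _) (fun m i h => h.le)
  have h3 := (h1.mul h2).sqrt
  rw [Real.sqrt_mul_self (limitProd_nonneg _ _ _)] at h3
  refine Tendsto.mul ?_ h3
  have h4 := (tendsto_mul_sin_div hq ((hC.add hε).const_mul Real.pi)).abs.div
    (hC.const_mul Real.pi) (mul_pos hp hC₀).ne'
  have e : |Real.pi * (C₀ + ε₀)| / (Real.pi * C₀) = |1 + ε₀ / C₀| := by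
    rw [abs_mul, abs_of_pos hp, mul_div_mul_left _ _ hp.ne',
      show 1 + ε₀ / C₀ = (C₀ + ε₀) / C₀ by field_simp, abs_div, abs_of_pos hC₀]
  rw [e] at h4
  refine h4.congr' ?_
  filter_upwards [hq'.eventually_gt_atTop 0] with m hm
  simp only [Pi.div_apply, abs_mul, abs_of_pos hm]
  field_simp

/-! ### The scale grows at most polynomially -/

theorem abs_log_sub_log_le {x y m : ℝ} (hm : 0 < m) (hx : m ≤ x) (hy : m ≤ y) :
    |Real.log x - Real.log y| ≤ |x - y| / m := by
  have key : ∀ x y, m ≤ x → m ≤ y → Real.log x - Real.log y ≤ |x - y| / m := by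
    intro x y hx hy
    have hx0 := hm.trans_le hx
    have hy0 := hm.trans_le hy
    rw [← Real.log_div hx0.ne' hy0.ne']
    refine (Real.log_le_sub_one_of_pos (div_pos hx0 hy0)).trans ?_
    rw [show x / y - 1 = (x - y) / y by field_simp]
    calc (x - y) / y ≤ |x - y| / y := by gcongr; exact le_abs_self _
      _ ≤ |x - y| / m := by gcongr
  rw [abs_le]
  have h1 := key x y hx hy
  have h2 := key y x hy hx
  rw [abs_sub_comm] at h2
  exact ⟨by linarith, h1⟩

theorem prod_two_mul_sin {q : ℕ} (hq : 1 ≤ q) :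
    ∏ t ∈ Finset.Ico 1 q, 2 * Real.sin (Real.pi * t / q) = q := by
  obtain ⟨p, rfl⟩ : ∃ p, q = p + 1 := ⟨q - 1, by omega⟩
  have hprim := Complex.isPrimitiveRoot_exp (p + 1) (by omega)
  have h := congrArg norm hprim.prod_one_sub_pow_eq_order
  rw [norm_prod] at h
  have hr : ‖(p : ℂ) + 1‖ = ((p + 1 : ℕ) : ℝ) := by
    rw [← Nat.cast_add_one, Complex.norm_natCast]
  rw [hr] at h
  refine Eq.trans ?_ h
  rw [Finset.prod_Ico_eq_prod_range]
  refine Finset.prod_congr (by simp) fun i hi => ?_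
  rw [Finset.mem_range] at hi
  have hpos : 0 ≤ Real.sin (Real.pi * ((1 + i : ℕ) : ℝ) / ((p + 1 : ℕ) : ℝ)) := by
    refine Real.sin_nonneg_of_nonneg_of_le_pi (by have := Real.pi_pos; positivity) ?_
    rw [div_le_iff₀ (by positivity)]
    have : ((1 + i : ℕ) : ℝ) ≤ ((p + 1 : ℕ) : ℝ) := by exact_mod_cast (by omega : 1 + i ≤ p + 1)
    have := Real.pi_pos
    gcongr
  rw [norm_sub_rev, ← Complex.exp_nat_mul,
    show ((i + 1 : ℕ) : ℂ) * (2 * Real.pi * Complex.I / ((p + 1 : ℕ) : ℂ)) =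
      Complex.I * ((2 * (Real.pi * ((1 + i : ℕ) : ℝ) / ((p + 1 : ℕ) : ℝ)) : ℝ) : ℂ) by
        push_cast; ring,
    Complex.norm_exp_I_mul_ofReal_sub_one, mul_div_cancel_left₀ _ (two_ne_zero), Real.norm_eq_abs,
    abs_of_nonneg (by positivity)]

theorem abs_log_sin_sub_le {q t : ℕ} (ht : 1 ≤ t) (htq : t < q) {x y : ℝ}
    (hx1 : Real.pi * (t - 1 / 2) / q ≤ x) (hx2 : x ≤ Real.pi * (t + 1 / 2) / q)
    (hy1 : Real.pi * (t - 1 / 2) / q ≤ y) (hy2 : y ≤ Real.pi * (t + 1 / 2) / q) :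
    |Real.log (2 * Real.sin x) - Real.log (2 * Real.sin y)| ≤
      Real.pi * (1 / t + 1 / ((q - t : ℕ) : ℝ)) := by
  have key : ∀ {t : ℕ}, 1 ≤ t → 2 * t ≤ q → ∀ {x y : ℝ}, Real.pi * (t - 1 / 2) / q ≤ x →
      x ≤ Real.pi * (t + 1 / 2) / q → Real.pi * (t - 1 / 2) / q ≤ y →
      y ≤ Real.pi * (t + 1 / 2) / q →
      |Real.log (2 * Real.sin x) - Real.log (2 * Real.sin y)| ≤ Real.pi * (1 / t) := by
    intro t ht htq x y hx1 hx2 hy1 hy2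
    have hq : (0 : ℝ) < q := by exact_mod_cast (by omega : 0 < q)
    have ht' : (0 : ℝ) < t := by exact_mod_cast ht
    have h1 := sin_lower_bound ht htq hx1 hx2
    have h2 := sin_lower_bound ht htq hy1 hy2
    have h0 : (0 : ℝ) < t / q := div_pos ht' hq
    rw [Real.log_mul two_ne_zero (h0.trans_le h1).ne',
      Real.log_mul two_ne_zero (h0.trans_le h2).ne', add_sub_add_left_eq_sub]
    refine (abs_log_sub_log_le h0 h1 h2).trans ?_
    have hxy : |x - y| ≤ Real.pi / q := by
      have e : Real.pi * (t + 1 / 2) / q - Real.pi * (t - 1 / 2) / q = Real.pi / q := by ring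
      rw [abs_le]
      constructor <;> linarith
    have hs : |Real.sin x - Real.sin y| ≤ |x - y| := by
      have := Real.abs_sin_sub_sin_le x y
      exact this
    calc |Real.sin x - Real.sin y| / (t / q) ≤ (Real.pi / q) / (t / q) := by
          gcongr
          exact hs.trans hxy
      _ = Real.pi * (1 / t) := by field_simp
  have hp := Real.pi_pos
  rcases le_total (2 * t) q with h | h
  · refine (key ht h hx1 hx2 hy1 hy2).trans ?_
    gcongr
    have : (0 : ℝ) ≤ 1 / ((q - t : ℕ) : ℝ) := by positivity
    linarith
  · have hq : (0 : ℝ) < q := by exact_mod_cast (by omega : 0 < q)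
    have e1 : Real.pi - Real.pi * (t + 1 / 2) / q = Real.pi * (((q - t : ℕ) : ℝ) - 1 / 2) / q := by
      rw [Nat.cast_sub htq.le]; field_simp; ring
    have e2 : Real.pi - Real.pi * (t - 1 / 2) / q = Real.pi * (((q - t : ℕ) : ℝ) + 1 / 2) / q := by
      rw [Nat.cast_sub htq.le]; field_simp; ring
    have := key (t := q - t) (x := Real.pi - x) (y := Real.pi - y) (by omega) (by omega)
      (by linarith) (by linarith) (by linarith) (by linarith)
    rw [Real.sin_pi_sub, Real.sin_pi_sub] at this
    refine this.trans ?_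
    gcongr
    have : (0 : ℝ) ≤ 1 / (t : ℝ) := by positivity
    linarith

theorem sum_inv_Ico_le (q : ℕ) : ∑ t ∈ Finset.Ico 1 q, 1 / (t : ℝ) ≤ 1 + Real.log q := by
  refine le_trans ?_ (harmonic_le_one_add_log q)
  rw [harmonic_eq_sum_Icc]
  push_cast
  simp only [one_div]
  refine Finset.sum_le_sum_of_subset_of_nonneg ?_ (fun _ _ _ => by positivity)
  intro t ht
  rw [Finset.mem_Ico] at ht
  rw [Finset.mem_Icc]
  omega

/-- The angles are compared with those of `∏ 2 sin (π t / q) = q`: the sines differ by `O(1/q)` and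
are at least of order `min t (q - t) / q`, so that the logarithms differ by a harmonic sum. -/
theorem abs_log_sudlerScale_le {q q' : ℕ} (hq : 1 ≤ q) {C : ℝ} (hC : 0 < C) (hC1 : C ≤ 1) :
    |Real.log (sudlerScale q q' C)| ≤
      |Real.log (2 * Real.pi * C)| + (2 * Real.pi + 2 * Real.pi * Real.log q) := by
  have hp := Real.pi_pos
  have hq' : (0 : ℝ) < q := by exact_mod_cast hq
  have hpos : ∀ t ∈ Finset.Ico 1 q, 2 * Real.sin (pairAngle q q' C t) ≠ 0 := by
    intro t ht
    rw [Finset.mem_Ico] at ht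
    exact (mul_pos two_pos (sin_pairAngle_pos hC hC1 ht.1 ht.2)).ne'
  have hpos2 : ∀ t ∈ Finset.Ico 1 q, 2 * Real.sin (Real.pi * t / q) ≠ 0 := by
    intro t ht h0
    have := prod_two_mul_sin hq
    rw [Finset.prod_eq_zero ht h0] at this
    linarith
  have h1 := prod_two_mul_sin hq
  have h2 : Real.log (sudlerScale q q' C) = Real.log (2 * Real.pi * C) +
      ∑ t ∈ Finset.Ico 1 q, (Real.log (2 * Real.sin (pairAngle q q' C t)) -
        Real.log (2 * Real.sin (Real.pi * t / q))) := by
    rw [Finset.sum_sub_distrib, ← Real.log_prod hpos, ← Real.log_prod hpos2, h1, sudlerScale,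
      Real.log_mul (by positivity) (Finset.prod_ne_zero_iff.2 hpos),
      Real.log_div (by positivity) hq'.ne']
    ring
  rw [h2]
  refine (abs_add_le _ _).trans (add_le_add le_rfl ?_)
  refine (Finset.abs_sum_le_sum_abs _ _).trans ?_
  calc ∑ t ∈ Finset.Ico 1 q, |Real.log (2 * Real.sin (pairAngle q q' C t)) -
          Real.log (2 * Real.sin (Real.pi * t / q))|
      ≤ ∑ t ∈ Finset.Ico 1 q, Real.pi * (1 / (t : ℝ) + 1 / ((q - t : ℕ) : ℝ)) := by
        refine Finset.sum_le_sum fun t ht => ?_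
        rw [Finset.mem_Ico] at ht
        obtain ⟨b1, b2⟩ := pairAngle_bounds (q' := q') hq hC hC1 t
        refine abs_log_sin_sub_le ht.1 ht.2 b1 b2 ?_ ?_ <;> gcongr <;> linarith
    _ = Real.pi * (∑ t ∈ Finset.Ico 1 q, 1 / (t : ℝ) + ∑ t ∈ Finset.Ico 1 q, 1 / (t : ℝ)) := by
        rw [← Finset.mul_sum, Finset.sum_add_distrib]
        congr 2
        refine Finset.sum_nbij' (fun t => q - t) (fun t => q - t) ?_ ?_ ?_ ?_ ?_ <;>
          intro t ht <;> simp only [Finset.mem_Ico] at ht ⊢ <;> first | rfl | omega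
    _ ≤ Real.pi * ((1 + Real.log q) + (1 + Real.log q)) := by
        have := sum_inv_Ico_le q
        gcongr
    _ = 2 * Real.pi + 2 * Real.pi * Real.log q := by ring

/-! ### Linear recurrences with convergent inhomogeneity -/

/-- Going backwards in the recurrence is contracting: a value `|w m| ≥ ε` would force growth like
`a ^ j` afterwards. -/
theorem tendsto_zero_of_expanding {a : ℝ} (ha : 1 < a) {w : ℕ → ℝ}
    (hw : Tendsto (fun m => w (m + 1) - a * w m) atTop (𝓝 0))
    (hs : Tendsto (fun m => w m / a ^ m) atTop (𝓝 0)) : Tendsto w atTop (𝓝 0) := by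
  rw [Metric.tendsto_atTop]
  intro ε hε
  have hδ : 0 < ε * (a - 1) / 2 := by
    have := sub_pos.2 ha
    positivity
  obtain ⟨M, hM⟩ := (Metric.tendsto_atTop.1 hw) _ hδ
  refine ⟨M, fun m hm => ?_⟩
  rw [Real.dist_eq, sub_zero]
  by_contra! hwm
  have key : ∀ j, a ^ j * (ε / 2) ≤ |w (m + j)| - ε / 2 := by
    intro j
    induction j with
    | zero => simp; linarith
    | succ j ih =>
      have h1 := hM (m + j) (by omega)
      rw [Real.dist_eq, sub_zero] at h1
      have h2 : |a * w (m + j)| ≤ |w (m + j + 1)| + |w (m + j + 1) - a * w (m + j)| := by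
        have := abs_sub (w (m + j + 1)) (w (m + j + 1) - a * w (m + j))
        rwa [sub_sub_cancel] at this
      rw [abs_mul, abs_of_pos (by linarith : 0 < a)] at h2
      have h3 := mul_le_mul_of_nonneg_left ih (by linarith : 0 ≤ a)
      rw [← add_assoc, pow_succ]
      nlinarith
  have hlim := ((hs.comp (tendsto_add_atTop_nat m)).abs)
  rw [abs_zero] at hlim
  have hle : ε / 2 / a ^ m ≤ 0 := by
    refine ge_of_tendsto hlim (Eventually.of_forall fun j => ?_)
    have hp := pow_pos (by linarith : 0 < a) m
    have hp' := pow_pos (by linarith : 0 < a) j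
    simp only [Function.comp]
    rw [abs_div, abs_of_pos (pow_pos (by linarith : 0 < a) (j + m)), pow_add,
      div_le_div_iff₀ hp (by positivity)]
    have h := key j
    rw [Nat.add_comm m j] at h
    nlinarith
  have : 0 < ε / 2 / a ^ m := by
    have := pow_pos (by linarith : 0 < a) m
    positivity
  linarith

theorem tendsto_zero_of_contracting {b : ℝ} (hb : |b| < 1) {y : ℕ → ℝ}
    (hy : Tendsto (fun m => y (m + 1) - b * y m) atTop (𝓝 0)) : Tendsto y atTop (𝓝 0) := by
  rw [Metric.tendsto_atTop]
  intro ε hε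
  have h1b := sub_pos.2 hb
  obtain ⟨M, hM⟩ := (Metric.tendsto_atTop.1 hy) (ε * (1 - |b|) / 2) (by positivity)
  have key : ∀ j, |y (M + j)| ≤ |b| ^ j * |y M| + ε / 2 := by
    intro j
    induction j with
    | zero => simp; linarith
    | succ j ih =>
      have h1 := hM (M + j) (by omega)
      rw [Real.dist_eq, sub_zero] at h1
      have h2 : |y (M + j + 1)| ≤ |y (M + j + 1) - b * y (M + j)| + |b * y (M + j)| := by
        have := abs_add_le (y (M + j + 1) - b * y (M + j)) (b * y (M + j))
        rwa [sub_add_cancel] at this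
      rw [abs_mul] at h2
      have h3 := mul_le_mul_of_nonneg_left ih (abs_nonneg b)
      rw [← add_assoc, pow_succ]
      nlinarith
  have hlim := ((tendsto_pow_atTop_nhds_zero_of_lt_one (abs_nonneg b) hb).mul_const |y M|)
  rw [zero_mul] at hlim
  obtain ⟨J, hJ⟩ := (Metric.tendsto_atTop.1 hlim) (ε / 2) (by positivity)
  refine ⟨M + J, fun m hm => ?_⟩
  obtain ⟨j, rfl⟩ : ∃ j, m = M + j := ⟨m - M, by omega⟩
  have h1 := hJ j (by omega)
  rw [Real.dist_eq, sub_zero] at h1 ⊢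
  have := key j
  have := le_abs_self (|b| ^ j * |y M|)
  linarith

/-- A solution of a second order recurrence with characteristic roots `|b| < 1 < a` and convergent
inhomogeneity converges, unless it grows like `a ^ m`. -/
theorem tendsto_of_recurrence {a b L : ℝ} (ha : 1 < a) (hb : |b| < 1) {y : ℕ → ℝ}
    (hy : Tendsto (fun m => y (m + 2) - (a + b) * y (m + 1) + a * b * y m) atTop (𝓝 L))
    (hs : Tendsto (fun m => y m / a ^ m) atTop (𝓝 0)) :
    Tendsto y atTop (𝓝 (L / ((1 - a) * (1 - b)))) := by
  have ha1 : 1 - a ≠ 0 := by linarith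
  have hb1 : 1 - b ≠ 0 := by linarith [(abs_lt.1 hb).2]
  set y₀ := L / ((1 - a) * (1 - b)) with hy₀
  have hy₀' : y₀ - (a + b) * y₀ + a * b * y₀ = L := by
    rw [hy₀]
    field_simp
    ring
  have hpow := tendsto_pow_atTop_atTop_of_one_lt ha
  have hw : Tendsto (fun m => (y (m + 1) - y₀) - b * (y m - y₀)) atTop (𝓝 0) := by
    refine tendsto_zero_of_expanding ha ?_ ?_
    · have h := hy.sub_const L
      rw [sub_self] at h
      refine h.congr fun m => ?_
      rw [← hy₀']
      ring
    · have h1 := (hs.comp (tendsto_add_atTop_nat 1)).const_mul a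
      have h2 := hs.const_mul b
      have h3 : Tendsto (fun m : ℕ => (b * y₀ - y₀) / a ^ m) atTop (𝓝 0) :=
        tendsto_const_nhds.div_atTop hpow
      have h := (h1.sub h2).add h3
      simp only [mul_zero, sub_zero, add_zero] at h
      refine h.congr fun m => ?_
      have hp := pow_pos (by linarith : 0 < a) m
      simp only [Function.comp, pow_succ]
      field_simp
      ring
  have h := (tendsto_zero_of_contracting hb (y := fun m => y m - y₀) hw).add_const y₀
  simpa using h

/-! ### Splitting a Sudler product into shorter ones -/

/-- The Sudler product `∏_{r=1}^N 2 |sin π r α|`. -/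
noncomputable def sudlerProd (α : ℝ) (N : ℕ) : ℝ :=
  ∏ r ∈ Finset.range N, 2 * |Real.sin (Real.pi * (((r + 1 : ℕ) : ℝ) * α))|

/-- A block of `q_n` consecutive factors, starting after the `M`-th one, is a perturbed product
whose perturbation is given by the distance of `M α` from an integer. -/
theorem sudlerProd_add_cfDen (d : ℕ → ℕ) {n M : ℕ} {z : ℤ} {ε : ℝ}
    (h : (M : ℝ) * cfValue d = z + (-1) ^ (n + 1) * (ε / cfDen d n)) :
    sudlerProd (cfValue d) (M + cfDen d n) =
      sudlerProd (cfValue d) M * perturbedProd d n ε := by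
  rw [sudlerProd, Finset.prod_range_add, sudlerProd, perturbedProd]
  congr 1
  rw [← Finset.Ico_add_one_right_eq_Icc, Finset.prod_Ico_eq_prod_range]
  refine Finset.prod_congr (by simp) fun i _ => ?_
  congr 1
  refine abs_sin_of_eq (Or.inl rfl) z ?_
  push_cast
  linear_combination Real.pi * h

theorem sudlerProd_cfDen (d : ℕ → ℕ) (n : ℕ) :
    sudlerProd (cfValue d) (cfDen d n) = perturbedProd d n 0 := by
  have := sudlerProd_add_cfDen d (n := n) (M := 0) (z := 0) (ε := 0) (by simp)
  simpa [sudlerProd] using this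

theorem cfDen_mul_cfValue (d : ℕ → ℕ) (n : ℕ) :
    (cfDen d n : ℝ) * cfValue d = cfNum d n + (-1) ^ (n + 1) * cfAbsErr d n := by
  have : ((-1 : ℝ) ^ (n + 1)) * (-1) ^ (n + 1) = 1 := by rw [← mul_pow]; simp
  rw [cfAbsErr, cfErr]
  linear_combination (-(cfDen d n * cfValue d - cfNum d n)) * this

/-- Successive blocks of `q_n` factors are shifted by `q_n α`, that is, modulo `1`, by the error of
the `n`-th convergent, so that their perturbations form an arithmetic progression. -/
theorem sudlerProd_add_mul_cfDen (d : ℕ → ℕ) {n : ℕ} (hn : cfDen d n ≠ 0) {M : ℕ} {z : ℤ} {x : ℝ}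
    (h : (M : ℝ) * cfValue d = z + (-1) ^ (n + 1) * (x * cfAbsErr d n)) (c : ℕ) :
    sudlerProd (cfValue d) (M + c * cfDen d n) =
      sudlerProd (cfValue d) M *
        ∏ s ∈ Finset.range c, perturbedProd d n ((s + x) * cfGap d n) := by
  induction c with
  | zero => simp
  | succ c ih =>
    have hn' : (cfDen d n : ℝ) ≠ 0 := Nat.cast_ne_zero.2 hn
    rw [Finset.prod_range_succ, ← mul_assoc, ← ih, Nat.succ_mul, ← add_assoc,
      sudlerProd_add_cfDen d (z := z + c * cfNum d n) (ε := (c + x) * cfGap d n)]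
    push_cast
    rw [cfGap]
    field_simp
    linear_combination h + c * cfDen_mul_cfValue d n

section Period

variable {ℓ : ℕ} (a : ZMod ℓ → ℕ)

/-- The product with `c q_{n+ℓ} = q_n + q_{n+2ℓ}` factors, cut into blocks in two ways. -/
theorem perturbedProd_relation_even (hℓ : 1 ≤ ℓ) (ha : ∀ j, 1 ≤ a j) (he : Even ℓ) (n : ℕ) :
    perturbedProd (digits a) n 0 * perturbedProd (digits a) (n + ℓ + ℓ)
        (rootA a ^ 2 * cfGap (digits a) (n + ℓ + ℓ)) =
      ∏ s ∈ Finset.range (cInt a),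
        perturbedProd (digits a) (n + ℓ) (s * cfGap (digits a) (n + ℓ)) := by
  have hA := one_lt_rootA a hℓ ha
  have hpos : ∀ n, cfDen (digits a) (n + ℓ) ≠ 0 := by
    intro n
    obtain ⟨j, hj⟩ : ∃ j, n + ℓ = j + 1 := ⟨n + ℓ - 1, by omega⟩
    have := cfDen_pos (digits a) (fun n => ha _) j
    rw [hj]
    omega
  have hq : cfDen (digits a) n + cfDen (digits a) (n + ℓ + ℓ) =
      0 + cInt a * cfDen (digits a) (n + ℓ) := by
    have := cfDen_add_two_period a n
    rw [he.neg_one_pow] at this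
    have h2 : (cfDen (digits a) n : ℝ) + cfDen (digits a) (n + ℓ + ℓ) =
      0 + cInt a * cfDen (digits a) (n + ℓ) := by linarith
    exact_mod_cast h2
  have h1 := sudlerProd_add_mul_cfDen (digits a) (hpos n) (M := 0) (z := 0) (x := 0) (by simp)
    (cInt a)
  rw [← hq, sudlerProd_add_cfDen (digits a) (z := cfNum (digits a) n)
    (ε := rootA a ^ 2 * cfGap (digits a) (n + ℓ + ℓ)), sudlerProd_cfDen] at h1
  · simpa [sudlerProd] using h1
  · rw [cfDen_mul_cfValue, cfGap, cfAbsErr_add_period a hℓ ha, cfAbsErr_add_period a hℓ ha,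
      show n + ℓ + ℓ + 1 = n + 1 + (ℓ + ℓ) by ring, pow_add _ _ (ℓ + ℓ),
      (Even.add_self ℓ).neg_one_pow]
    have : (cfDen (digits a) (n + ℓ + ℓ) : ℝ) ≠ 0 := Nat.cast_ne_zero.2 (hpos (n + ℓ))
    push_cast
    field_simp

/-- The product with `q_{n+2ℓ} = q_n + c q_{n+ℓ}` factors, cut into blocks. -/
theorem perturbedProd_relation_odd (hℓ : 1 ≤ ℓ) (ha : ∀ j, 1 ≤ a j) (ho : Odd ℓ) (n : ℕ) :
    perturbedProd (digits a) (n + ℓ + ℓ) 0 = perturbedProd (digits a) n 0 *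
      ∏ s ∈ Finset.range (cInt a),
        perturbedProd (digits a) (n + ℓ) ((s - rootA a) * cfGap (digits a) (n + ℓ)) := by
  have hA := one_lt_rootA a hℓ ha
  have hpos : cfDen (digits a) (n + ℓ) ≠ 0 := by
    obtain ⟨j, hj⟩ : ∃ j, n + ℓ = j + 1 := ⟨n + ℓ - 1, by omega⟩
    have := cfDen_pos (digits a) (fun n => ha _) j
    rw [hj]
    omega
  have hq : cfDen (digits a) (n + ℓ + ℓ) =
      cfDen (digits a) n + cInt a * cfDen (digits a) (n + ℓ) := by
    have := cfDen_add_two_period a n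
    rw [ho.neg_one_pow] at this
    have h2 : (cfDen (digits a) (n + ℓ + ℓ) : ℝ) =
      cfDen (digits a) n + cInt a * cfDen (digits a) (n + ℓ) := by linarith
    exact_mod_cast h2
  have h1 := sudlerProd_add_mul_cfDen (digits a) hpos (M := cfDen (digits a) n)
    (z := cfNum (digits a) n) (x := -rootA a) (by
      rw [cfDen_mul_cfValue, cfAbsErr_add_period a hℓ ha,
        show n + ℓ + 1 = n + 1 + ℓ by ring, pow_add _ _ ℓ, ho.neg_one_pow]
      push_cast
      field_simp) (cInt a)
  rw [← hq, sudlerProd_cfDen, sudlerProd_cfDen] at h1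
  simpa [← sub_eq_add_neg] using h1

end Period

/-! ### The infinite products -/

theorem hasProd_limitProd {C : ℝ} (hC : 0 < C) (hC1 : C ≤ 1) (θ s : ℝ) :
    HasProd (fun i : ℕ => |1 - s ^ 2 / shiftedArg C θ (i + 1) ^ 2|) (limitProd C θ s) := by
  have h : Summable fun i : ℕ => ‖-(s ^ 2 / shiftedArg C θ (i + 1) ^ 2)‖ := by
    simpa only [norm_neg] using (summable_div_shiftedArg_sq hC hC1 θ s).norm
  have h2 := (multipliable_one_add_of_summable h).norm.hasProd
  simpa only [limitProd, ← sub_eq_add_neg, Real.norm_eq_abs] using h2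

theorem limitProd_pos {C : ℝ} (hC : 0 < C) (hC1 : C ≤ 1) {θ s : ℝ}
    (h : ∀ i : ℕ, shiftedArg C θ (i + 1) ^ 2 ≠ s ^ 2) : 0 < limitProd C θ s := by
  refine lt_of_le_of_ne (limitProd_nonneg C θ s) (Ne.symm ?_)
  have h1 : Summable fun i : ℕ => ‖-(s ^ 2 / shiftedArg C θ (i + 1) ^ 2)‖ := by
    simpa only [norm_neg] using (summable_div_shiftedArg_sq hC hC1 θ s).norm
  have hne : ∀ i : ℕ, 1 + -(s ^ 2 / shiftedArg C θ (i + 1) ^ 2) ≠ 0 := by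
    intro i h0
    have hpos : shiftedArg C θ (i + 1) ^ 2 ≠ 0 := by
      intro h3
      rw [h3] at h0
      simp at h0
    exact h i ((div_eq_one_iff_eq hpos).1 (by linarith)).symm
  have h2 := tprod_one_add_ne_zero_of_summable hne h1
  rw [← norm_ne_zero_iff, (multipliable_one_add_of_summable h1).norm_tprod] at h2
  simpa only [limitProd, ← sub_eq_add_neg, Real.norm_eq_abs] using h2

theorem hasProd_rpow {ι : Type*} {f : ι → ℝ} {P : ℝ} (hf : ∀ i, 0 ≤ f i) (h : HasProd f P)
    (hP : P ≠ 0) (r : ℝ) : HasProd (fun i => f i ^ r) (P ^ r) := by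
  have h1 := (Real.continuousAt_rpow_const P r (Or.inl hP)).tendsto.comp h
  refine h1.congr fun s => ?_
  exact (Real.finsetProd_rpow s f (fun i _ => hf i) r).symm

/-- A holomorphic function whose absolute value on the real line is
`|1 + ε / C| limitProd C θ (1 + 2 ε / C)`. -/
noncomputable def entireProd (C θ : ℝ) (z : ℂ) : ℂ :=
  (1 + z / C) * ∏' i : ℕ, (1 + -((1 + 2 * z / C) ^ 2 / (shiftedArg C θ (i + 1) : ℂ) ^ 2))

theorem summable_norm_entireProd {C : ℝ} (hC : 0 < C) (hC1 : C ≤ 1) (θ : ℝ) (z : ℂ) :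
    Summable fun i : ℕ => ‖-((1 + 2 * z / C) ^ 2 / (shiftedArg C θ (i + 1) : ℂ) ^ 2)‖ := by
  refine (summable_div_shiftedArg_sq hC hC1 θ ‖1 + 2 * z / C‖).congr fun i => ?_
  rw [norm_neg, norm_div, norm_pow, norm_pow, Complex.norm_real, Real.norm_eq_abs, sq_abs]

theorem norm_entireProd {C : ℝ} (hC : 0 < C) (hC1 : C ≤ 1) (θ ε : ℝ) :
    ‖entireProd C θ ε‖ = |1 + ε / C| * limitProd C θ (1 + 2 * ε / C) := by
  rw [entireProd, norm_mul,
    (multipliable_one_add_of_summable (summable_norm_entireProd hC hC1 θ ε)).norm_tprod]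
  congr 1
  · rw [← Real.norm_eq_abs, ← Complex.norm_real]
    push_cast
    rfl
  · refine tprod_congr fun i => ?_
    rw [← Real.norm_eq_abs, ← Complex.norm_real]
    push_cast
    rw [sub_eq_add_neg]

theorem differentiable_entireProd {C : ℝ} (hC : 0 < C) (hC1 : C ≤ 1) (θ : ℝ) :
    Differentiable ℂ (entireProd C θ) := by
  refine Differentiable.mul (by fun_prop) (differentiableOn_univ.1 ?_)
  have hball : ∀ R : ℝ, 0 < R → DifferentiableOn ℂ (fun z : ℂ => ∏' i : ℕ,
      (1 + -((1 + 2 * z / C) ^ 2 / (shiftedArg C θ (i + 1) : ℂ) ^ 2))) (Metric.ball 0 R) := by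
    intro R hR
    have hs := summable_div_shiftedArg_sq hC hC1 θ (1 + 2 * R / C)
    have hprod : HasProdLocallyUniformlyOn
        (fun (i : ℕ) (z : ℂ) => 1 + -((1 + 2 * z / C) ^ 2 / (shiftedArg C θ (i + 1) : ℂ) ^ 2))
        (fun z => ∏' i : ℕ, (1 + -((1 + 2 * z / C) ^ 2 / (shiftedArg C θ (i + 1) : ℂ) ^ 2)))
        (Metric.ball 0 R) := by
      refine hs.hasProdLocallyUniformlyOn_nat_one_add Metric.isOpen_ball
        (Eventually.of_forall fun i z hz => ?_) (fun i => by fun_prop)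
      rw [norm_neg, norm_div, norm_pow, norm_pow, Complex.norm_real, Real.norm_eq_abs, sq_abs]
      rw [mem_ball_zero_iff] at hz
      gcongr
      refine (norm_add_le _ _).trans ?_
      rw [norm_one, norm_div, norm_mul, Complex.norm_real, Real.norm_eq_abs, abs_of_pos hC,
        Complex.norm_two]
      gcongr
    exact hprod.differentiableOn (Eventually.of_forall fun s => by fun_prop) Metric.isOpen_ball
  intro z _
  have hz : z ∈ Metric.ball (0 : ℂ) (‖z‖ + 1) := by simp
  exact (((hball _ (by positivity)) z hz).differentiableAt
    (Metric.isOpen_ball.mem_nhds hz)).differentiableWithinAt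

theorem contDiff_entireProd {C : ℝ} (hC : 0 < C) (hC1 : C ≤ 1) (θ : ℝ) :
    ContDiff ℝ ∞ (fun ε : ℝ => entireProd C θ ε) := by
  have h : ContDiff ℂ ∞ (entireProd C θ) := (differentiable_entireProd hC hC1 θ).contDiff
  exact (h.restrict_scalars ℝ).comp Complex.ofRealCLM.contDiff

section Period

variable {ℓ : ℕ} (a : ZMod ℓ → ℕ)

/-! ### The limit function up to its constant -/

/-- The limit of the normalised products, without the constant factor. -/
noncomputable def limitShape (k : ℕ) (ε : ℝ) : ℝ :=
  |1 + ε / absEC a k| * limitProd (absEC a k) (alphaSigma a k) (1 + 2 * ε / absEC a k)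

theorem limitShape_mul_absEC (hℓ : 1 ≤ ℓ) (ha : ∀ j, 1 ≤ a j) (k : ℕ) (x : ℝ) :
    limitShape a k (x * absEC a k) =
      |1 + x| * limitProd (absEC a k) (alphaSigma a k) (1 + 2 * x) := by
  have := absEC_pos a hℓ ha k
  rw [limitShape, mul_div_cancel_right₀ _ this.ne', ← mul_assoc, mul_div_cancel_right₀ _ this.ne']

/-- The infinite product does not vanish at `ε = (s + r a) |e_k c_k|` for integers `s`, `r` with
`s + r b ≥ 0`, because at a zero `t / |e_k c_k| - {t α_{σ_k}}` is `s + r a` or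
`-1 - s - r a`, and conjugation turns this into `s + r b = -{t α_{σ_k}}` or
`s + r b = {t α_{σ_k}} - 1`. -/
theorem limitProd_pos_of_conj (hℓ : 1 ≤ ℓ) (ha : ∀ j, 1 ≤ a j) {k : ℕ} (hk : 1 ≤ k) (s r : ℤ)
    (h : 0 ≤ (s : ℝ) + r * rootB a) :
    0 < limitProd (absEC a k) (alphaSigma a k) (1 + 2 * (s + r * rootA a)) := by
  refine limitProd_pos (absEC_pos a hℓ ha k) (absEC_le_one a hℓ ha k) fun i hi => ?_
  set θ := alphaSigma a k with hθ
  have hf := Int.self_sub_floor (((i + 1 : ℕ) : ℝ) * θ)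
  have hf1 := Int.fract_lt_one (((i + 1 : ℕ) : ℝ) * θ)
  have hf0 : 0 < Int.fract (((i + 1 : ℕ) : ℝ) * θ) := by
    refine lt_of_le_of_ne (Int.fract_nonneg _) fun h0 => ?_
    rw [← h0] at hf
    have := eq_zero_of_mul_alphaSigma_eq a hℓ ha k (x := (i + 1 : ℕ))
      (y := ⌊((i + 1 : ℕ) : ℝ) * θ⌋) (by rw [Int.cast_natCast, ← hθ]; linarith)
    omega
  rcases sq_eq_sq_iff_eq_or_eq_neg.1 hi with h1 | h1 <;> unfold shiftedArg at h1
  · have := conjugate_relation a hℓ ha hk (t := (i + 1 : ℕ))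
      (N := ⌊((i + 1 : ℕ) : ℝ) * θ⌋) (s := s) (r := r) (by
        rw [Int.cast_natCast, ← hθ]
        linear_combination h1 / 2 - hf)
    rw [Int.cast_natCast, ← hθ] at this
    linarith
  · have := conjugate_relation a hℓ ha hk (t := (i + 1 : ℕ))
      (N := ⌊((i + 1 : ℕ) : ℝ) * θ⌋) (s := -1 - s) (r := -r) (by
        rw [Int.cast_natCast, ← hθ]
        simp only [Int.cast_sub, Int.cast_neg, Int.cast_one]
        linear_combination h1 / 2 - hf)
    rw [Int.cast_natCast, ← hθ] at this
    simp only [Int.cast_sub, Int.cast_neg, Int.cast_one] at this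
    linarith


end Period

section Period

variable {ℓ : ℕ} (a : ZMod ℓ → ℕ)

/-! ### The constant factor -/

/-- The scale of the Sudler products of length `q_n`, for `n ≥ 1`. -/
noncomputable def periodScale (n : ℕ) : ℝ :=
  sudlerScale (cfDen (digits a) n) (cfDen (digits a) (n - 1)) (cfGap (digits a) n)

/-- The shape of the Sudler products of length `q_n`, for `n ≥ 1`. -/
noncomputable def periodShape (n : ℕ) (ε : ℝ) : ℝ :=
  sudlerShape (cfDen (digits a) n) (cfDen (digits a) (n - 1)) (cfGap (digits a) n) ε

theorem perturbedProd_digits_eq (hℓ : 1 ≤ ℓ) (ha : ∀ j, 1 ≤ a j) {n : ℕ} (hn : 1 ≤ n) (ε : ℝ) :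
    perturbedProd (digits a) n ε = periodScale a n * periodShape a n ε := by
  obtain ⟨j, rfl⟩ : ∃ j, n = j + 1 := ⟨n - 1, by omega⟩
  exact perturbedProd_eq_scale_mul_shape _ (fun _ => ha _) j (cfGap_pos a hℓ ha hn)
    (cfGap_le_one a hℓ ha _) ε

theorem one_le_cfDen_digits (ha : ∀ j, 1 ≤ a j) {n : ℕ} (hn : 1 ≤ n) : 1 ≤ cfDen (digits a) n := by
  obtain ⟨j, rfl⟩ : ∃ j, n = j + 1 := ⟨n - 1, by omega⟩
  exact cfDen_pos _ (fun _ => ha _) j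

theorem periodScale_pos (hℓ : 1 ≤ ℓ) (ha : ∀ j, 1 ≤ a j) {n : ℕ} (hn : 1 ≤ n) :
    0 < periodScale a n :=
  sudlerScale_pos (one_le_cfDen_digits a ha hn) (cfGap_pos a hℓ ha hn) (cfGap_le_one a hℓ ha _)

theorem tendsto_periodShape (hℓ : 1 ≤ ℓ) (ha : ∀ j, 1 ≤ a j) {k : ℕ} (hk : 1 ≤ k) {ι : Type*}
    {l : Filter ι} {μ : ι → ℕ} (hμ : Tendsto μ l atTop) {ε : ι → ℝ} {ε₀ : ℝ}
    (hε : Tendsto ε l (𝓝 ε₀)) :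
    Tendsto (fun i => periodShape a (μ i * ℓ + k) (ε i)) l (𝓝 (limitShape a k ε₀)) := by
  refine tendsto_sudlerShape
    ((tendsto_cfDen_atTop (digits a) (fun _ => ha _)).comp
      ((tendsto_mul_period_add hℓ k).comp hμ))
    ((tendsto_cfGap a hℓ ha k).comp hμ) (absEC_pos a hℓ ha k)
    (fun i => cfGap_pos a hℓ ha (by omega)) (fun i => cfGap_le_one a hℓ ha _) hε ?_ ?_
  · obtain ⟨j, rfl⟩ : ∃ j, k = j + 1 := ⟨k - 1, by omega⟩
    exact (tendsto_cfDen_ratio a hℓ ha j).comp hμ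
  · intro t ht z hz
    have := eq_zero_of_mul_alphaSigma_eq a hℓ ha k (x := t) (y := z) (by rwa [Int.cast_natCast])
    omega

/-- The scale is polynomial in `q_n`, whose logarithm is only linear in `m`. -/
theorem tendsto_log_periodScale_div (hℓ : 1 ≤ ℓ) (ha : ∀ j, 1 ≤ a j) {k : ℕ} (hk : 1 ≤ k) :
    Tendsto (fun m : ℕ => Real.log (periodScale a (m * ℓ + k)) / rootA a ^ m) atTop (𝓝 0) := by
  have hA := one_lt_rootA a hℓ ha
  have hp := Real.pi_pos
  have hpow := tendsto_pow_atTop_atTop_of_one_lt hA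
  have hy := cfAbsErr_pos a hℓ ha k
  have hlogq : ∀ m : ℕ, Real.log (cfDen (digits a) (m * ℓ + k)) ≤
      m * Real.log (rootA a) - Real.log (cfAbsErr (digits a) k) := by
    intro m
    have h1 := cfGap_le_one a hℓ ha (m * ℓ + k)
    have hq : (0 : ℝ) < cfDen (digits a) (m * ℓ + k) := by
      exact_mod_cast one_le_cfDen_digits a ha (by omega : 1 ≤ m * ℓ + k)
    have hAm := pow_pos (show 0 < rootA a by linarith) m
    rw [cfGap, cfAbsErr_mul_period_add a hℓ ha, ← mul_div_assoc, div_le_one hAm] at h1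
    have h2 := Real.log_le_log (mul_pos hq hy) h1
    rw [Real.log_mul hq.ne' hy.ne', Real.log_pow] at h2
    linarith
  have hgap : Tendsto (fun m : ℕ => |Real.log (2 * Real.pi * cfGap (digits a) (m * ℓ + k))|) atTop
      (𝓝 |Real.log (2 * Real.pi * absEC a k)|) := by
    have hC := absEC_pos a hℓ ha k
    exact (((tendsto_cfGap a hℓ ha k).const_mul (2 * Real.pi)).log (by positivity)).abs
  have hlin : Tendsto (fun m : ℕ => (m : ℝ) / rootA a ^ m) atTop (𝓝 0) := by
    simpa using tendsto_pow_const_div_const_pow_of_one_lt 1 hA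
  have h1 := (hgap.add_const
    (2 * Real.pi - 2 * Real.pi * Real.log (cfAbsErr (digits a) k))).div_atTop hpow
  have h2 := h1.add (hlin.const_mul (2 * Real.pi * Real.log (rootA a)))
  rw [mul_zero, add_zero] at h2
  refine squeeze_zero_norm (fun m => ?_) h2
  have hAm := pow_pos (show 0 < rootA a by linarith) m
  have hb := abs_log_sudlerScale_le (q' := cfDen (digits a) (m * ℓ + k - 1))
    (one_le_cfDen_digits a ha (by omega : 1 ≤ m * ℓ + k))
    (cfGap_pos a hℓ ha (by omega : 1 ≤ m * ℓ + k)) (cfGap_le_one a hℓ ha _)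
  rw [Real.norm_eq_abs, abs_div, abs_of_pos hAm, mul_div_assoc', ← add_div]
  gcongr
  rw [periodScale]
  refine hb.trans ?_
  have := mul_le_mul_of_nonneg_left (hlogq m) (show 0 ≤ 2 * Real.pi by positivity)
  linarith

theorem tendsto_periodScale_of_recurrence (hℓ : 1 ≤ ℓ) (ha : ∀ j, 1 ≤ a j) {k : ℕ} (hk : 1 ≤ k)
    {L : ℝ} (h : Tendsto (fun m : ℕ => Real.log (periodScale a (m * ℓ + k + ℓ + ℓ)) -
      cInt a * Real.log (periodScale a (m * ℓ + k + ℓ)) +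
        (-1) ^ ℓ * Real.log (periodScale a (m * ℓ + k))) atTop (𝓝 L)) :
    Tendsto (fun m : ℕ => periodScale a (m * ℓ + k)) atTop
      (𝓝 (Real.exp (L / ((1 - rootA a) * (1 - rootB a))))) := by
  have h1 := tendsto_of_recurrence (one_lt_rootA a hℓ ha) (abs_rootB_lt_one a hℓ ha)
    (y := fun m => Real.log (periodScale a (m * ℓ + k))) (L := L) (by
      rw [rootA_add_rootB, rootA_mul_rootB a hℓ ha]
      refine h.congr fun m => ?_
      rw [show (m + 2) * ℓ + k = m * ℓ + k + ℓ + ℓ by ring,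
        show (m + 1) * ℓ + k = m * ℓ + k + ℓ by ring])
    (tendsto_log_periodScale_div a hℓ ha hk)
  refine (Real.continuous_exp.tendsto _ |>.comp h1).congr fun m => ?_
  exact Real.exp_log (periodScale_pos a hℓ ha (by omega))

theorem limitShape_pos_of_conj (hℓ : 1 ≤ ℓ) (ha : ∀ j, 1 ≤ a j) {k : ℕ} (hk : 1 ≤ k) (s r : ℤ)
    (h : 0 ≤ (s : ℝ) + r * rootB a) (h1 : 1 + ((s : ℝ) + r * rootA a) ≠ 0) :
    0 < limitShape a k ((s + r * rootA a) * absEC a k) := by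
  rw [limitShape_mul_absEC a hℓ ha]
  exact mul_pos (abs_pos.2 h1) (limitProd_pos_of_conj a hℓ ha hk s r h)

theorem rootA_sq_eq (hℓ : 1 ≤ ℓ) (ha : ∀ j, 1 ≤ a j) (he : Even ℓ) :
    rootA a ^ 2 = ((-1 : ℤ) : ℝ) + (cInt a : ℤ) * rootA a := by
  have h1 := rootA_mul_rootB a hℓ ha
  rw [he.neg_one_pow] at h1
  push_cast
  rw [← rootA_add_rootB a]
  linear_combination -h1

theorem limitShape_nat_pos (hℓ : 1 ≤ ℓ) (ha : ∀ j, 1 ≤ a j) {k : ℕ} (hk : 1 ≤ k) (s : ℕ) :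
    0 < limitShape a k (s * absEC a k) := by
  have := limitShape_pos_of_conj a hℓ ha hk (s : ℤ) 0 (by simp) (by
    simp only [Int.cast_natCast, Int.cast_zero, zero_mul, add_zero]
    positivity)
  simpa using this

theorem limitShape_rootA_sq_pos (hℓ : 1 ≤ ℓ) (ha : ∀ j, 1 ≤ a j) (he : Even ℓ) {k : ℕ}
    (hk : 1 ≤ k) : 0 < limitShape a k (rootA a ^ 2 * absEC a k) := by
  have hB : 0 ≤ ((-1 : ℤ) : ℝ) + (cInt a : ℤ) * rootB a := by
    have h1 := rootA_mul_rootB a hℓ ha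
    rw [he.neg_one_pow] at h1
    push_cast
    rw [← rootA_add_rootB a]
    nlinarith [sq_nonneg (rootB a)]
  rw [rootA_sq_eq a hℓ ha he]
  refine limitShape_pos_of_conj a hℓ ha hk _ _ hB ?_
  rw [← rootA_sq_eq a hℓ ha he]
  positivity

/-- For odd `ℓ` the root `rootA` lies strictly between `c` and `c + 1`. -/
theorem natCast_ne_rootA (hℓ : 1 ≤ ℓ) (ha : ∀ j, 1 ≤ a j) (ho : Odd ℓ) (s : ℕ) :
    (s : ℝ) ≠ rootA a := by
  have hA := one_lt_rootA a hℓ ha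
  have h1 := rootA_mul_rootB a hℓ ha
  rw [ho.neg_one_pow] at h1
  have h2 := rootA_add_rootB a
  have h3 := abs_lt.1 (abs_rootB_lt_one a hℓ ha)
  have h4 : rootB a < 0 := by
    by_contra! h
    have := mul_nonneg (show 0 ≤ rootA a by linarith) h
    linarith
  intro hs
  have h5 : (cInt a : ℝ) < s := by linarith
  have h6 : (s : ℝ) < (cInt a + 1 : ℕ) := by push_cast; linarith [h3.1]
  have h5' : cInt a < s := by exact_mod_cast h5
  have h6' : s < cInt a + 1 := by exact_mod_cast h6
  omega

theorem limitShape_sub_rootA_pos (hℓ : 1 ≤ ℓ) (ha : ∀ j, 1 ≤ a j) (ho : Odd ℓ) {k : ℕ}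
    (hk : 1 ≤ k) (s : ℕ) : 0 < limitShape a k ((s - rootA a) * absEC a k) := by
  have hA := one_lt_rootA a hℓ ha
  have h1 := rootA_mul_rootB a hℓ ha
  rw [ho.neg_one_pow] at h1
  have h4 : rootB a < 0 := by
    by_contra! h
    have := mul_nonneg (show 0 ≤ rootA a by linarith) h
    linarith
  have h := limitShape_pos_of_conj a hℓ ha hk (s : ℤ) (-1) (by
    push_cast
    have : (0 : ℝ) ≤ s := Nat.cast_nonneg s
    linarith) (by
    intro h0
    apply natCast_ne_rootA a hℓ ha ho (s + 1)
    push_cast at h0 ⊢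
    linarith)
  push_cast at h
  rwa [neg_one_mul, ← sub_eq_add_neg] at h

theorem tendsto_log_prod_periodShape {k : ℕ} {μ : ℕ → ℕ} {c : ℕ} {x : ℕ → ℝ}
    (hpos : ∀ s, 0 < limitShape a k (x s * absEC a k))
    (h : ∀ s, Tendsto (fun m => periodShape a (μ m) (x s * cfGap (digits a) (μ m))) atTop
      (𝓝 (limitShape a k (x s * absEC a k)))) :
    Tendsto (fun m => Real.log (∏ s ∈ Finset.range c,
      periodShape a (μ m) (x s * cfGap (digits a) (μ m)))) atTop
      (𝓝 (Real.log (∏ s ∈ Finset.range c, limitShape a k (x s * absEC a k)))) :=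
  (tendsto_finsetProd _ fun s _ => h s).log (Finset.prod_pos fun s _ => hpos s).ne'

theorem tendsto_periodShape_mul_cfGap (hℓ : 1 ≤ ℓ) (ha : ∀ j, 1 ≤ a j) {k : ℕ} (hk : 1 ≤ k)
    (x : ℝ) (i : ℕ) :
    Tendsto (fun m : ℕ => periodShape a (m * ℓ + k + i * ℓ)
      (x * cfGap (digits a) (m * ℓ + k + i * ℓ))) atTop (𝓝 (limitShape a k (x * absEC a k))) := by
  have e : ∀ m, m * ℓ + k + i * ℓ = (m + i) * ℓ + k := fun m => by ring
  simp only [e]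
  exact tendsto_periodShape a hℓ ha hk (tendsto_add_atTop_nat i)
    (((tendsto_cfGap a hℓ ha k).comp (tendsto_add_atTop_nat i)).const_mul x)

/-- The value of the constant factor for even `ℓ`, read off from `perturbedProd_relation_even`. The
value of the shape at `0` occurs on both sides of that relation and cancels. -/
theorem tendsto_periodScale_even (hℓ : 1 ≤ ℓ) (ha : ∀ j, 1 ≤ a j) (he : Even ℓ) {k : ℕ}
    (hk : 1 ≤ k) :
    Tendsto (fun m : ℕ => periodScale a (m * ℓ + k)) atTop
      (𝓝 (limitShape a k (rootA a ^ 2 * absEC a k) ^ (1 / ((cInt a : ℝ) - 2)) *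
        ∏ s ∈ Finset.Icc 1 (cInt a - 1),
          limitShape a k (s * absEC a k) ^ (-(1 / ((cInt a : ℝ) - 2))))) := by
  have hc : (3 : ℝ) ≤ cInt a := by exact_mod_cast three_le_cInt a hℓ ha he
  have hpos := limitShape_nat_pos a hℓ ha hk
  have hposA := limitShape_rootA_sq_pos a hℓ ha he hk
  have t0 := tendsto_periodShape_mul_cfGap a hℓ ha hk 0 0
  have t2 := tendsto_periodShape_mul_cfGap a hℓ ha hk (rootA a ^ 2) 2
  have t1 := fun s : ℕ => tendsto_periodShape_mul_cfGap a hℓ ha hk s 1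
  have e2 : ∀ n, n + 2 * ℓ = n + ℓ + ℓ := fun n => by ring
  simp only [zero_mul, add_zero, one_mul, e2] at t0 t1 t2
  have hpos0 : 0 < limitShape a k 0 := by simpa using hpos 0
  have tl := ((tendsto_log_prod_periodShape a (c := cInt a) (x := fun s => (s : ℝ)) hpos t1).sub
    (t0.log hpos0.ne')).sub (t2.log hposA.ne')
  have hrec := tendsto_periodScale_of_recurrence a hℓ ha hk (tl.congr' ?_)
  · convert hrec using 2
    have hden : (1 - rootA a) * (1 - rootB a) = -((cInt a : ℝ) - 2) := by
      have h1 := rootA_mul_rootB a hℓ ha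
      rw [he.neg_one_pow] at h1
      have h2 := rootA_add_rootB a
      linear_combination h1 - h2
    rw [hden, Finset.range_eq_Ico,
      Finset.prod_eq_prod_Ico_succ_bot (by exact_mod_cast (by linarith : (0 : ℝ) < cInt a)),
      Nat.cast_zero, zero_mul, zero_add,
      Real.log_mul hpos0.ne' (Finset.prod_pos fun s _ => hpos s).ne',
      Real.log_prod (fun s _ => (hpos s).ne')]
    have hIcc : Finset.Icc 1 (cInt a - 1) = Finset.Ico 1 (cInt a) := by
      ext s
      have := three_le_cInt a hℓ ha he
      simp only [Finset.mem_Icc, Finset.mem_Ico]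
      omega
    rw [hIcc, Real.rpow_def_of_pos hposA]
    simp only [fun s => Real.rpow_def_of_pos (hpos s)]
    rw [← Real.exp_sum, ← Real.exp_add, ← Finset.sum_mul]
    congr 1
    have : (cInt a : ℝ) - 2 ≠ 0 := by linarith
    field_simp
    ring
  · have ev1 := t0.eventually_ne hpos0.ne'
    have ev2 := t2.eventually_ne hposA.ne'
    have ev3 : ∀ᶠ m : ℕ in atTop, ∏ s ∈ Finset.range (cInt a),
        periodShape a (m * ℓ + k + ℓ) (s * cfGap (digits a) (m * ℓ + k + ℓ)) ≠ 0 :=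
      (tendsto_finsetProd _ fun s _ => t1 s).eventually_ne (Finset.prod_pos fun s _ => hpos s).ne'
    filter_upwards [ev1, ev2, ev3] with m h0 h2 h3
    have hrel := perturbedProd_relation_even a hℓ ha he (m * ℓ + k)
    have p0 := (periodScale_pos a hℓ ha (by omega : 1 ≤ m * ℓ + k)).ne'
    have p1 := (periodScale_pos a hℓ ha (by omega : 1 ≤ m * ℓ + k + ℓ)).ne'
    have p2 := (periodScale_pos a hℓ ha (by omega : 1 ≤ m * ℓ + k + ℓ + ℓ)).ne'
    simp only [perturbedProd_digits_eq a hℓ ha (by omega : 1 ≤ m * ℓ + k),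
      perturbedProd_digits_eq a hℓ ha (by omega : 1 ≤ m * ℓ + k + ℓ),
      perturbedProd_digits_eq a hℓ ha (by omega : 1 ≤ m * ℓ + k + ℓ + ℓ)] at hrel
    rw [Finset.prod_mul_distrib, Finset.prod_const, Finset.card_range] at hrel
    have hlog := congrArg Real.log hrel
    rw [Real.log_mul (mul_ne_zero p0 h0) (mul_ne_zero p2 h2), Real.log_mul p0 h0,
      Real.log_mul p2 h2, Real.log_mul (pow_ne_zero _ p1) h3, Real.log_pow] at hlog
    rw [he.neg_one_pow]
    linarith

/-- The value of the constant factor for odd `ℓ`, read off from `perturbedProd_relation_odd`. -/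
theorem tendsto_periodScale_odd (hℓ : 1 ≤ ℓ) (ha : ∀ j, 1 ≤ a j) (ho : Odd ℓ) {k : ℕ}
    (hk : 1 ≤ k) :
    Tendsto (fun m : ℕ => periodScale a (m * ℓ + k)) atTop
      (𝓝 (∏ s ∈ Finset.range (cInt a),
          limitShape a k ((s - rootA a) * absEC a k) ^ (-(1 / (cInt a : ℝ))))) := by
  have hc : (1 : ℝ) ≤ cInt a := by exact_mod_cast one_le_cInt a ha
  have hpos := limitShape_sub_rootA_pos a hℓ ha ho hk
  have t0 := tendsto_periodShape_mul_cfGap a hℓ ha hk 0 0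
  have t2 := tendsto_periodShape_mul_cfGap a hℓ ha hk 0 2
  have t1 := fun s : ℕ => tendsto_periodShape_mul_cfGap a hℓ ha hk (s - rootA a) 1
  have e2 : ∀ n, n + 2 * ℓ = n + ℓ + ℓ := fun n => by ring
  simp only [zero_mul, add_zero, one_mul, e2] at t0 t1 t2
  have hpos0 : 0 < limitShape a k 0 := by simpa using limitShape_nat_pos a hℓ ha hk 0
  have tl := ((tendsto_log_prod_periodShape a (c := cInt a) (x := fun s => (s : ℝ) - rootA a)
    hpos t1).add (t0.log hpos0.ne')).sub (t2.log hpos0.ne')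
  have hrec := tendsto_periodScale_of_recurrence a hℓ ha hk (tl.congr' ?_)
  · convert hrec using 2
    have hden : (1 - rootA a) * (1 - rootB a) = -(cInt a : ℝ) := by
      have h1 := rootA_mul_rootB a hℓ ha
      rw [ho.neg_one_pow] at h1
      have h2 := rootA_add_rootB a
      linear_combination h1 - h2
    rw [hden, Real.log_prod (fun s _ => (hpos s).ne')]
    simp only [fun s => Real.rpow_def_of_pos (hpos s)]
    rw [← Real.exp_sum, ← Finset.sum_mul]
    rw [add_sub_cancel_right, div_neg, mul_neg, mul_one_div]
  · have ev1 := t0.eventually_ne hpos0.ne'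
    have ev2 := t2.eventually_ne hpos0.ne'
    have ev3 : ∀ᶠ m : ℕ in atTop, ∏ s ∈ Finset.range (cInt a),
        periodShape a (m * ℓ + k + ℓ) ((s - rootA a) * cfGap (digits a) (m * ℓ + k + ℓ)) ≠ 0 :=
      (tendsto_finsetProd _ fun s _ => t1 s).eventually_ne (Finset.prod_pos fun s _ => hpos s).ne'
    filter_upwards [ev1, ev2, ev3] with m h0 h2 h3
    have hrel := perturbedProd_relation_odd a hℓ ha ho (m * ℓ + k)
    have p0 := (periodScale_pos a hℓ ha (by omega : 1 ≤ m * ℓ + k)).ne'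
    have p1 := (periodScale_pos a hℓ ha (by omega : 1 ≤ m * ℓ + k + ℓ)).ne'
    have p2 := (periodScale_pos a hℓ ha (by omega : 1 ≤ m * ℓ + k + ℓ + ℓ)).ne'
    simp only [perturbedProd_digits_eq a hℓ ha (by omega : 1 ≤ m * ℓ + k),
      perturbedProd_digits_eq a hℓ ha (by omega : 1 ≤ m * ℓ + k + ℓ),
      perturbedProd_digits_eq a hℓ ha (by omega : 1 ≤ m * ℓ + k + ℓ + ℓ)] at hrel
    rw [Finset.prod_mul_distrib, Finset.prod_const, Finset.card_range] at hrel
    have hlog := congrArg Real.log hrel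
    rw [Real.log_mul (mul_ne_zero p0 h0) (mul_ne_zero (pow_ne_zero _ p1) h3), Real.log_mul p0 h0,
      Real.log_mul p2 h2, Real.log_mul (pow_ne_zero _ p1) h3, Real.log_pow] at hlog
    rw [ho.neg_one_pow]
    linarith

end Period

section Period

variable {ℓ : ℕ} (a : ZMod ℓ → ℕ)

/-! ### Convergence and regularity -/

theorem limitShape_eq_norm (hℓ : 1 ≤ ℓ) (ha : ∀ j, 1 ≤ a j) (k : ℕ) (ε : ℝ) :
    limitShape a k ε = ‖entireProd (absEC a k) (alphaSigma a k) ε‖ :=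
  (norm_entireProd (absEC_pos a hℓ ha k) (absEC_le_one a hℓ ha k) _ ε).symm

theorem continuous_limitShape (hℓ : 1 ≤ ℓ) (ha : ∀ j, 1 ≤ a j) (k : ℕ) :
    Continuous (limitShape a k) := by
  simp only [funext (limitShape_eq_norm a hℓ ha k)]
  exact (contDiff_entireProd (absEC_pos a hℓ ha k) (absEC_le_one a hℓ ha k) _).continuous.norm

theorem contDiffOn_limitShape (hℓ : 1 ≤ ℓ) (ha : ∀ j, 1 ≤ a j) (k : ℕ) :
    ContDiffOn ℝ ∞ (limitShape a k) {ε | limitShape a k ε ≠ 0} := by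
  simp only [funext (limitShape_eq_norm a hℓ ha k)]
  intro ε hε
  exact ((contDiff_entireProd (absEC_pos a hℓ ha k) (absEC_le_one a hℓ ha k)
    _).contDiffAt.norm ℝ (norm_ne_zero_iff.1 hε)).contDiffWithinAt

theorem tendstoLocallyUniformly_perturbedProd (hℓ : 1 ≤ ℓ) (ha : ∀ j, 1 ≤ a j) {k : ℕ}
    (hk : 1 ≤ k) {K : ℝ}
    (hK : Tendsto (fun m : ℕ => periodScale a (m * ℓ + k)) atTop (𝓝 K)) :
    TendstoLocallyUniformly (fun (m : ℕ) (ε : ℝ) => perturbedProd (digits a) (m * ℓ + k) ε)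
      (fun ε => K * limitShape a k ε) atTop := by
  rw [tendstoLocallyUniformly_iff_filter]
  intro x
  rw [tendstoUniformlyOnFilter_iff_tendsto]
  -- Convergence at `x` along both variables at once, together with the continuity of the limit,
  -- amounts to uniform convergence near `x`.
  have h1 : Tendsto (fun p : ℕ × ℝ => K * limitShape a k p.2) (atTop ×ˢ 𝓝 x)
      (𝓝 (K * limitShape a k x)) :=
    ((continuous_limitShape a hℓ ha k).tendsto x |>.comp tendsto_snd).const_mul K
  have h2 : Tendsto (fun p : ℕ × ℝ => perturbedProd (digits a) (p.1 * ℓ + k) p.2)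
      (atTop ×ˢ 𝓝 x) (𝓝 (K * limitShape a k x)) := by
    simp only [fun p : ℕ × ℝ =>
      perturbedProd_digits_eq a hℓ ha (by omega : 1 ≤ p.1 * ℓ + k) p.2]
    exact (hK.comp tendsto_fst).mul (tendsto_periodShape a hℓ ha hk tendsto_fst tendsto_snd)
  exact (h1.prodMk_nhds h2).mono_right (nhds_le_uniformity _)

/-! ### The infinite product formulas -/

theorem hasProd_factorEven (hℓ : 1 ≤ ℓ) (ha : ∀ j, 1 ≤ a j) (he : Even ℓ) {k : ℕ} (hk : 1 ≤ k)
    (ε : ℝ) :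
    HasProd (fun t : ℕ => factorEven a k ε (t + 1))
      (limitProd (absEC a k) (alphaSigma a k) (1 + 2 * ε / absEC a k) *
        limitProd (absEC a k) (alphaSigma a k) (1 + 2 * rootA a ^ 2) ^ (1 / ((cInt a : ℝ) - 2)) *
        ∏ s ∈ Finset.Icc 1 (cInt a - 1),
          limitProd (absEC a k) (alphaSigma a k) (1 + 2 * s) ^ (-(1 / ((cInt a : ℝ) - 2)))) := by
  have hC := absEC_pos a hℓ ha k
  have hC1 := absEC_le_one a hℓ ha k
  have hB : 2 / |rootB a| ^ 2 = 2 * rootA a ^ 2 := by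
    rw [abs_rootB a hℓ ha]
    have := one_lt_rootA a hℓ ha
    field_simp
  have hA := limitShape_rootA_sq_pos a hℓ ha he hk
  rw [limitShape_mul_absEC a hℓ ha] at hA
  refine ((hasProd_limitProd hC hC1 _ _).mul ?_).mul (hasProd_prod fun s _ => ?_)
  · rw [hB]
    exact hasProd_rpow (fun _ => abs_nonneg _) (hasProd_limitProd hC hC1 _ _)
      (right_ne_zero_of_mul hA.ne') _
  · have hs := limitShape_nat_pos a hℓ ha hk s
    rw [limitShape_mul_absEC a hℓ ha] at hs
    exact hasProd_rpow (fun _ => abs_nonneg _) (hasProd_limitProd hC hC1 _ _)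
      (right_ne_zero_of_mul hs.ne') _

theorem hasProd_factorOdd (hℓ : 1 ≤ ℓ) (ha : ∀ j, 1 ≤ a j) (ho : Odd ℓ) {k : ℕ} (hk : 1 ≤ k)
    (ε : ℝ) :
    HasProd (fun t : ℕ => factorOdd a k ε (t + 1))
      (limitProd (absEC a k) (alphaSigma a k) (1 + 2 * ε / absEC a k) *
        ∏ s ∈ Finset.range (cInt a),
          limitProd (absEC a k) (alphaSigma a k) (1 + 2 * (s - rootA a)) ^
            (-(1 / (cInt a : ℝ)))) := by
  have hC := absEC_pos a hℓ ha k
  have hC1 := absEC_le_one a hℓ ha k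
  have hB : 1 / |rootB a| = rootA a := by rw [abs_rootB a hℓ ha, one_div_one_div]
  refine (hasProd_limitProd hC hC1 _ _).mul (hasProd_prod fun s _ => ?_)
  have hs := limitShape_sub_rootA_pos a hℓ ha ho hk s
  rw [limitShape_mul_absEC a hℓ ha] at hs
  rw [hB]
  exact hasProd_rpow (fun _ => abs_nonneg _) (hasProd_limitProd hC hC1 _ _)
    (right_ne_zero_of_mul hs.ne') _

theorem prod_Icc_one_add (c : ℕ) (hc : 1 ≤ c) :
    ∏ s ∈ Finset.Icc 1 (c - 1), (1 + (s : ℝ)) = (Nat.factorial c : ℝ) := by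
  obtain ⟨n, rfl⟩ : ∃ n, c = n + 1 := ⟨c - 1, by omega⟩
  rw [Nat.add_sub_cancel]
  induction n with
  | zero => simp
  | succ n ih =>
    rw [← Finset.insert_Icc_right_eq_Icc_add_one (by omega), Finset.prod_insert (by simp),
      ih (by omega), Nat.factorial_succ (n + 1)]
    push_cast
    ring

theorem limit_eq_even (hℓ : 1 ≤ ℓ) (ha : ∀ j, 1 ≤ a j) (he : Even ℓ) {k : ℕ} (hk : 1 ≤ k)
    (ε : ℝ) :
    limitShape a k (rootA a ^ 2 * absEC a k) ^ (1 / ((cInt a : ℝ) - 2)) *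
        (∏ s ∈ Finset.Icc 1 (cInt a - 1),
          limitShape a k (s * absEC a k) ^ (-(1 / ((cInt a : ℝ) - 2)))) * limitShape a k ε =
      prefactorEven a k ε * ∏' t : ℕ, factorEven a k ε (t + 1) := by
  have hc := three_le_cInt a hℓ ha he
  have hB : 1 / |rootB a| ^ 2 = rootA a ^ 2 := by
    rw [abs_rootB a hℓ ha]
    have := one_lt_rootA a hℓ ha
    field_simp
  have hfac : ∏ s ∈ Finset.Icc 1 (cInt a - 1), |1 + (s : ℝ)| ^ (-(1 / ((cInt a : ℝ) - 2))) =
      1 / (Nat.factorial (cInt a) : ℝ) ^ (1 / ((cInt a : ℝ) - 2)) := by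
    rw [Real.finsetProd_rpow _ _ (fun _ _ => abs_nonneg _), ← Finset.abs_prod,
      prod_Icc_one_add _ (by omega), Nat.abs_cast, Real.rpow_neg (Nat.cast_nonneg _), ← one_div]
  rw [(hasProd_factorEven a hℓ ha he hk ε).tprod_eq, limitShape_mul_absEC a hℓ ha,
    Real.mul_rpow (abs_nonneg _) (limitProd_nonneg _ _ _)]
  simp only [limitShape_mul_absEC a hℓ ha,
    fun s : ℕ => Real.mul_rpow (z := -(1 / ((cInt a : ℝ) - 2))) (abs_nonneg (1 + (s : ℝ)))
      (limitProd_nonneg (absEC a k) (alphaSigma a k) (1 + 2 * s))]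
  rw [Finset.prod_mul_distrib, hfac, prefactorEven, hB, limitShape,
    abs_of_pos (by positivity : 0 < 1 + rootA a ^ 2)]
  ring

theorem limit_eq_odd (hℓ : 1 ≤ ℓ) (ha : ∀ j, 1 ≤ a j) (ho : Odd ℓ) {k : ℕ} (hk : 1 ≤ k)
    (ε : ℝ) :
    (∏ s ∈ Finset.range (cInt a),
        limitShape a k ((s - rootA a) * absEC a k) ^ (-(1 / (cInt a : ℝ)))) * limitShape a k ε =
      prefactorOdd a k ε * ∏' t : ℕ, factorOdd a k ε (t + 1) := by
  have hpre : ∏ s ∈ Finset.range (cInt a), |1 + ((s : ℝ) - rootA a)| ^ (-(1 / (cInt a : ℝ))) =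
      (∏ s ∈ Finset.Icc 1 (cInt a), |(s : ℝ) - rootA a| ^ (1 / (cInt a : ℝ)))⁻¹ := by
    rw [← Finset.Ico_add_one_right_eq_Icc, Finset.prod_Ico_eq_prod_range, ← Finset.prod_inv_distrib]
    refine Finset.prod_congr (by simp) fun s _ => ?_
    rw [Real.rpow_neg (abs_nonneg _)]
    push_cast
    rw [add_sub_assoc]
  rw [(hasProd_factorOdd a hℓ ha ho hk ε).tprod_eq]
  simp only [limitShape_mul_absEC a hℓ ha,
    fun s : ℕ => Real.mul_rpow (z := -(1 / (cInt a : ℝ))) (abs_nonneg (1 + ((s : ℝ) - rootA a)))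
      (limitProd_nonneg (absEC a k) (alphaSigma a k) (1 + 2 * (s - rootA a)))]
  rw [Finset.prod_mul_distrib, hpre, prefactorOdd, limitShape]
  ring

end Period

end Sudler

theorem theorem1 (ℓ : ℕ) (hℓ : 1 ≤ ℓ) (a : ZMod ℓ → ℕ) (ha : ∀ j, 1 ≤ a j)
    (k : ℕ) (hk : 1 ≤ k) (hkℓ : k ≤ ℓ) :
    ∃ G : ℝ → ℝ,
      TendstoLocallyUniformly
        (fun (m : ℕ) (ε : ℝ) => Sudler.perturbedProd (Sudler.digits a) (m * ℓ + k) ε)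
        G atTop ∧
      (Even ℓ → ∀ ε : ℝ,
        Multipliable (fun t : ℕ => Sudler.factorEven a k ε (t + 1)) ∧
        G ε = Sudler.prefactorEven a k ε * ∏' t : ℕ, Sudler.factorEven a k ε (t + 1)) ∧
      (Odd ℓ → ∀ ε : ℝ,
        Multipliable (fun t : ℕ => Sudler.factorOdd a k ε (t + 1)) ∧
        G ε = Sudler.prefactorOdd a k ε * ∏' t : ℕ, Sudler.factorOdd a k ε (t + 1)) ∧
      Continuous G ∧
      ContDiffOn ℝ ∞ G {ε : ℝ | G ε ≠ 0} := by
  have hreg : ∀ K : ℝ, Continuous (fun ε => K * Sudler.limitShape a k ε) ∧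
      ContDiffOn ℝ ∞ (fun ε => K * Sudler.limitShape a k ε)
        {ε : ℝ | K * Sudler.limitShape a k ε ≠ 0} := fun K =>
    ⟨(Sudler.continuous_limitShape a hℓ ha k).const_mul K,
      (contDiffOn_const.mul (Sudler.contDiffOn_limitShape a hℓ ha k)).mono
        fun _ h => right_ne_zero_of_mul h⟩
  rcases Nat.even_or_odd ℓ with he | ho
  · exact ⟨_, Sudler.tendstoLocallyUniformly_perturbedProd a hℓ ha hk
      (Sudler.tendsto_periodScale_even a hℓ ha he hk),
      fun _ ε => ⟨(Sudler.hasProd_factorEven a hℓ ha he hk ε).multipliable,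
        Sudler.limit_eq_even a hℓ ha he hk ε⟩,
      fun ho => absurd he (Nat.not_even_iff_odd.2 ho), hreg _⟩
  · exact ⟨_, Sudler.tendstoLocallyUniformly_perturbedProd a hℓ ha hk
      (Sudler.tendsto_periodScale_odd a hℓ ha ho hk),
      fun he => absurd he (Nat.not_even_iff_odd.2 ho),
      fun _ ε => ⟨(Sudler.hasProd_factorOdd a hℓ ha ho hk ε).multipliable,
        Sudler.limit_eq_odd a hℓ ha ho hk ε⟩, hreg _⟩
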